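/- Let $F$ be Thompson's group, that is, the group of all orientation-preserving piecewise linear homeomorphisms of $[0,1]$ with finitely many breakpoints, all of which have dyadic rational coordinates, and with all slopes powers of $2$. A \emph{tree pair} of size $n\ge 1$ is an ordered pair $(S,T)$ of finite rooted binary trees with $n$ carets (internal nodes) each. It is \emph{reduced} if $n=1$ or if, with leaves numbered from left to right, there is no $j$ such that in both trees the leaves $j$ and $j+1$ are the two leaves of one caret. A reduced tree pair represents the element of $F$ that maps, for each $i$, the dyadic interval of the $i$-th leaf of $S$ affinely onto that of the $i$-th leaf of $T$. For $k\ge 1$ let $X_k$ be the set of unordered $k$-tuples (multisets of cardinality $k$) of reduced tree pairs, and let $\mathrm{Sph}^{\max}_k(n)\subseteq X_k$ be the finite set of those tuples in which the largest size of a component is $n$. The \emph{density} of a set $A\subseteq X_k$ is $\lim_{n\to\infty}|A\cap \mathrm{Sph}^{\max}_k(n)|/|\mathrm{Sph}^{\max}_k(n)|$ if this limit exists; the \emph{lower density} of $A$ is the $\liminf$ of the same quotients. For a subgroup $H\le F$ let $T_H^{(k)}\subseteq X_k$ be the set of $k$-tuples whose components generate a subgroup of $F$ isomorphic to $H$, and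 let $\mathrm{Spec}^{\max}_k(F)$ be the set of all $H$ for which $T_H^{(k)}$ has positive lower density. Call $H$ \emph{persistent} if there is an $l$ such that $H\in\mathrm{Spec}^{\max}_k(F)$ for all $k\ge l$. \textbf{Theorem.} Let $\mu=8+4\sqrt3$. For every $k\ge 2$ we have $F\in \mathrm{Spec}^{\max}_k(F)$; more precisely, the lower density of $T_F^{(k)}$ is at least $$\frac1k\,\mu^{-9}\,\mu^{-3(k-2)} ,$$ and so the density of $T_F^{(k)}$, whenever it exists, is at least this number, and is positive. In particular, $F$ is a persistent subgroup of itself. -/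

import Mathlib

open Filter Topology

/-! ### Thompson's group `F` -/

/-- A real number is a dyadic rational if it has the form `a / 2 ^ n`. -/
def IsDyadic (x : ℝ) : Prop := ∃ (a : ℤ) (n : ℕ), x = a / 2 ^ n

theorem IsDyadic.add {x y : ℝ} (hx : IsDyadic x) (hy : IsDyadic y) : IsDyadic (x + y) := by
  obtain ⟨a, n, rfl⟩ := hx
  obtain ⟨b, k, rfl⟩ := hy
  refine ⟨a * 2 ^ k + b * 2 ^ n, n + k, ?_⟩
  push_cast
  field_simp
  ring

theorem IsDyadic.neg {x : ℝ} (hx : IsDyadic x) : IsDyadic (-x) := by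
  obtain ⟨a, n, rfl⟩ := hx
  exact ⟨-a, n, by push_cast; ring⟩

theorem IsDyadic.sub {x y : ℝ} (hx : IsDyadic x) (hy : IsDyadic y) : IsDyadic (x - y) := by
  rw [sub_eq_add_neg]
  exact hx.add hy.neg

theorem IsDyadic.zero : IsDyadic 0 := ⟨0, 0, by simp⟩

theorem IsDyadic.two_zpow_mul (m : ℤ) {x : ℝ} (hx : IsDyadic x) : IsDyadic (2 ^ m * x) := by
  obtain ⟨a, n, rfl⟩ := hx
  obtain ⟨k, rfl | rfl⟩ := m.eq_nat_or_neg
  · exact ⟨2 ^ k * a, n, by push_cast; rw [zpow_natCast]; ring⟩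
  · refine ⟨a, n + k, ?_⟩
    rw [zpow_neg, zpow_natCast, pow_add]
    field_simp

theorem IsDyadic.two_zpow (m : ℤ) : IsDyadic (2 ^ m) := by
  have := IsDyadic.two_zpow_mul m (x := 1) ⟨1, 0, by simp⟩
  simpa using this

/-- Thompson's group `F`: the group, under composition, of all orientation-preserving
homeomorphisms `f` of the unit interval that are piecewise linear with finitely many breakpoints,
all of whose breakpoints have dyadic rational coordinates, and that have the form
`y ↦ 2 ^ m * y + q`, with `m` an integer and `q` a dyadic rational, near every other point.
(The order isomorphisms of the unit interval are its orientation-preserving homeomorphisms.) -/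
def ThompsonF : Subgroup (unitInterval ≃o unitInterval) where
  carrier := {f | ∃ B : Set unitInterval, B.Finite ∧
    (∀ b ∈ B, IsDyadic (b : ℝ) ∧ IsDyadic (f b : ℝ)) ∧
    ∀ x, x ∉ B → ∃ (m : ℤ) (q : ℝ), IsDyadic q ∧ ∀ᶠ y in 𝓝 x, (f y : ℝ) = 2 ^ m * (y : ℝ) + q}
  one_mem' := ⟨∅, Set.finite_empty, by simp, fun x _ =>
    ⟨0, 0, IsDyadic.zero, Eventually.of_forall fun y => by simp⟩⟩
  mul_mem' := by
    rintro f g ⟨B, hBf, hBd, hB⟩ ⟨C, hCf, hCd, hC⟩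
    -- off the breakpoints, `g` maps dyadic points to dyadic points, in both directions
    have key : ∀ x : unitInterval, (IsDyadic (x : ℝ) ↔ IsDyadic (g x : ℝ)) := by
      intro x
      by_cases hx : x ∈ C
      · simp [hCd x hx]
      · obtain ⟨m, q, hq, h⟩ := hC x hx
        have hx' := h.self_of_nhds
        constructor
        · intro hd
          rw [hx']
          exact (hd.two_zpow_mul m).add hq
        · intro hd
          have : (x : ℝ) = 2 ^ (-m) * ((g x : ℝ) - q) := by
            rw [hx', zpow_neg]
            field_simp
            ring
          rw [this]
          exact (hd.sub hq).two_zpow_mul _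
    have keyf : ∀ x : unitInterval, IsDyadic (x : ℝ) → IsDyadic (f x : ℝ) := by
      intro x hd
      by_cases hx : x ∈ B
      · exact (hBd x hx).2
      · obtain ⟨m, q, hq, h⟩ := hB x hx
        rw [h.self_of_nhds]
        exact (hd.two_zpow_mul m).add hq
    refine ⟨C ∪ g ⁻¹' B, hCf.union (hBf.preimage g.injective.injOn), ?_, ?_⟩
    · rintro b (hb | hb)
      · exact ⟨(hCd b hb).1, keyf _ (hCd b hb).2⟩
      · exact ⟨(key b).2 (hBd _ hb).1, (hBd _ hb).2⟩
    · intro x hx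
      rw [Set.mem_union, not_or] at hx
      obtain ⟨m, q, hq, h⟩ := hC x hx.1
      obtain ⟨n, r, hr, h'⟩ := hB (g x) hx.2
      refine ⟨n + m, 2 ^ n * q + r, (hq.two_zpow_mul n).add hr, ?_⟩
      filter_upwards [h, g.continuous.continuousAt.eventually h'] with y h1 h2
      change ((f (g y) : unitInterval) : ℝ) = _
      rw [h2, h1, zpow_add₀ (by norm_num)]
      ring
  inv_mem' := by
    rintro f ⟨B, hBf, hBd, hB⟩
    refine ⟨f '' B, hBf.image f, ?_, ?_⟩
    · rintro _ ⟨b, hb, rfl⟩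
      refine ⟨(hBd b hb).2, ?_⟩
      change IsDyadic (f.symm (f b) : unitInterval)
      rw [f.symm_apply_apply]
      exact (hBd b hb).1
    · intro x hx
      have hx' : f.symm x ∉ B := fun h => hx ⟨_, h, f.apply_symm_apply x⟩
      obtain ⟨m, q, hq, h⟩ := hB _ hx'
      refine ⟨-m, -(2 ^ (-m) * q), (hq.two_zpow_mul (-m)).neg, ?_⟩
      filter_upwards [f.symm.continuous.continuousAt.eventually h] with y hy
      change ((f.symm y : unitInterval) : ℝ) = _
      rw [f.apply_symm_apply] at hy
      rw [hy, zpow_neg]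
      field_simp
      ring

/-! ### Reduced tree pairs

A finite rooted binary tree is a `BinaryTree Unit`: `nil` is the one-vertex tree (a single leaf),
and `node () l r` is the tree whose root caret carries `l` at its left and `r` at its right leaf.
The carets of a tree are its internal nodes, counted by `BinaryTree.numNodes`. -/

/-- The set of all `k` such that the leaves numbered `k` and `k + 1` of the tree (numbered from
left to right, starting with `0`) are the two leaves of one (exposed) caret. -/
def exposedCarets : BinaryTree Unit → Finset ℕ
  | .nil => ∅
  | .node _ .nil .nil => {0}
  | .node _ l r => exposedCarets l ∪ (exposedCarets r).image (l.numLeaves + ·)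

/-- A nonempty reduced tree pair: two binary trees with the same positive number of carets which,
unless they are single carets, have no exposed caret with the same leaf numbers in common. -/
structure ReducedTreePair where
  source : BinaryTree Unit
  target : BinaryTree Unit
  numNodes_eq : source.numNodes = target.numNodes
  numNodes_pos : 0 < source.numNodes
  reduced : source.numNodes = 1 ∨ Disjoint (exposedCarets source) (exposedCarets target)

/-- The size of a tree pair is the number of carets in either tree. -/
def ReducedTreePair.size (p : ReducedTreePair) : ℕ := p.source.numNodes

/-- The distances of the leaves from the root, from left to right. -/
def leafDepths : BinaryTree Unit → List ℕ
  | .nil => [0]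
  | .node _ l r => (leafDepths l ++ leafDepths r).map (· + 1)

/-- Place consecutive intervals of lengths `2 ^ (-d₁), 2 ^ (-d₂), …` in the domain, starting at
`0`, and consecutive intervals of lengths `2 ^ (-e₁), 2 ^ (-e₂), …` in the range. Then
`plMap [(d₁, e₁), (d₂, e₂), …]` maps the `i`-th interval of the domain affinely onto the `i`-th
interval of the range (and it has slope one to the right of the last one). -/
noncomputable def plMap : List (ℕ × ℕ) → ℝ → ℝ
  | [], x => x
  | (d, e) :: L, x =>
    if x ≤ 2 ^ (-d : ℤ) then 2 ^ ((d : ℤ) - e) * x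
    else 2 ^ (-e : ℤ) + plMap L (x - 2 ^ (-d : ℤ))

theorem plMap_zero (L : List (ℕ × ℕ)) : plMap L 0 = 0 := by
  rcases L with _ | ⟨⟨d, e⟩, L⟩
  · rfl
  · rw [plMap, if_pos (by positivity), mul_zero]

theorem two_zpow_mul_neg (d e : ℕ) :
    (2 : ℝ) ^ ((d : ℤ) - e) * 2 ^ (-d : ℤ) = 2 ^ (-e : ℤ) := by
  rw [← zpow_add₀ (by norm_num)]
  congr 1
  ring

theorem plMap_strictMono (L : List (ℕ × ℕ)) : StrictMono (plMap L) := by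
  induction L with
  | nil => intro x y h; exact h
  | cons a L ih =>
    obtain ⟨d, e⟩ := a
    intro x y h
    have h2 : (0 : ℝ) < 2 ^ ((d : ℤ) - e) := by positivity
    have h3 := two_zpow_mul_neg d e
    simp only [plMap]
    split_ifs with hx hy hy
    · exact mul_lt_mul_of_pos_left h h2
    · have h4 : plMap L 0 < plMap L (y - 2 ^ (-d : ℤ)) := ih (by linarith)
      rw [plMap_zero] at h4
      have := mul_le_mul_of_nonneg_left hx h2.le
      linarith
    · linarith
    · have := ih (sub_lt_sub_right h ((2 : ℝ) ^ (-d : ℤ)))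
      linarith

theorem plMap_swap (L : List (ℕ × ℕ)) (x : ℝ) : plMap (L.map Prod.swap) (plMap L x) = x := by
  induction L generalizing x with
  | nil => rfl
  | cons a L ih =>
    obtain ⟨d, e⟩ := a
    have h2 : (0 : ℝ) < 2 ^ ((d : ℤ) - e) := by positivity
    have h3 := two_zpow_mul_neg d e
    simp only [List.map_cons, Prod.swap_prod_mk, plMap]
    by_cases hx : x ≤ 2 ^ (-d : ℤ)
    · have := mul_le_mul_of_nonneg_left hx h2.le
      rw [if_pos hx, if_pos (by linarith), ← mul_assoc, ← zpow_add₀ (by norm_num)]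
      simp
    · have h4 : plMap L 0 < plMap L (x - 2 ^ (-d : ℤ)) := plMap_strictMono L (by linarith)
      rw [plMap_zero] at h4
      rw [if_neg hx, if_neg (by linarith), add_sub_cancel_left, ih]
      ring

theorem plMap_sum (L : List (ℕ × ℕ)) :
    plMap L (L.map fun a => (2 : ℝ) ^ (-a.1 : ℤ)).sum = (L.map fun a => (2 : ℝ) ^ (-a.2 : ℤ)).sum := by
  induction L with
  | nil => rfl
  | cons a L ih =>
    obtain ⟨d, e⟩ := a
    have h0 : 0 ≤ (L.map fun a => (2 : ℝ) ^ (-a.1 : ℤ)).sum :=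
      List.sum_nonneg (by simp only [List.mem_map]; rintro _ ⟨a, _, rfl⟩; positivity)
    simp only [List.map_cons, List.sum_cons, plMap]
    split_ifs with h
    · have h1 : (L.map fun a => (2 : ℝ) ^ (-a.1 : ℤ)).sum = 0 := by linarith
      rw [h1, plMap_zero] at ih
      rw [h1, ← ih, add_zero, add_zero, two_zpow_mul_neg]
    · rw [add_sub_cancel_left, ih]

theorem plMap_local (L : List (ℕ × ℕ)) : ∃ B : Set ℝ, B.Finite ∧
    (∀ b ∈ B, IsDyadic b ∧ IsDyadic (plMap L b)) ∧
    ∀ x, x ∉ B → ∃ (m : ℤ) (q : ℝ), IsDyadic q ∧ ∀ᶠ y in 𝓝 x, plMap L y = 2 ^ m * y + q := by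
  induction L with
  | nil => exact ⟨∅, Set.finite_empty, by simp, fun x _ =>
      ⟨0, 0, IsDyadic.zero, Eventually.of_forall fun y => by simp [plMap]⟩⟩
  | cons a L ih =>
    obtain ⟨d, e⟩ := a
    obtain ⟨B, hBf, hBd, hB⟩ := ih
    have hw : IsDyadic ((2 : ℝ) ^ (-d : ℤ)) := IsDyadic.two_zpow _
    refine ⟨insert (2 ^ (-d : ℤ)) ((fun b => b + 2 ^ (-d : ℤ)) '' B), (hBf.image _).insert _, ?_, ?_⟩
    · rintro b (rfl | ⟨b, hb, rfl⟩)
      · refine ⟨hw, ?_⟩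
        rw [plMap, if_pos le_rfl]
        exact hw.two_zpow_mul _
      · refine ⟨(hBd b hb).1.add hw, ?_⟩
        simp only [plMap]
        split_ifs
        · exact ((hBd b hb).1.add hw).two_zpow_mul _
        · rw [add_sub_cancel_right]
          exact (IsDyadic.two_zpow _).add (hBd b hb).2
    · intro x hx
      rw [Set.mem_insert_iff, not_or] at hx
      rcases lt_or_gt_of_ne hx.1 with h | h
      · refine ⟨(d : ℤ) - e, 0, IsDyadic.zero, ?_⟩
        filter_upwards [eventually_lt_nhds h] with y hy
        rw [plMap, if_pos hy.le, add_zero]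
      · have hx' : x - 2 ^ (-d : ℤ) ∉ B := fun h' => hx.2 ⟨_, h', by simp⟩
        obtain ⟨m, q, hq, hm⟩ := hB _ hx'
        refine ⟨m, 2 ^ (-e : ℤ) + (q - 2 ^ m * 2 ^ (-d : ℤ)),
          (IsDyadic.two_zpow _).add (hq.sub (hw.two_zpow_mul m)), ?_⟩
        have hc : Tendsto (fun y : ℝ => y - 2 ^ (-d : ℤ)) (𝓝 x) (𝓝 (x - 2 ^ (-d : ℤ))) :=
          (continuous_sub_right _).continuousAt
        filter_upwards [eventually_gt_nhds h, hc.eventually hm] with y hy hy'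
        rw [plMap, if_neg (not_le.2 hy), hy']
        ring

theorem length_leafDepths (T : BinaryTree Unit) : (leafDepths T).length = T.numNodes + 1 := by
  induction T with
  | nil => rfl
  | node _ l r hl hr =>
    simp only [leafDepths, List.length_map, List.length_append, hl, hr, BinaryTree.numNodes]
    ring

theorem sum_leafDepths (T : BinaryTree Unit) :
    ((leafDepths T).map fun d : ℕ => (2 : ℝ) ^ (-d : ℤ)).sum = 1 := by
  induction T with
  | nil => simp [leafDepths]
  | node _ l r hl hr =>
    have h : ∀ L : List ℕ, ((L.map (· + 1)).map fun d : ℕ => (2 : ℝ) ^ (-d : ℤ)).sum =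
        (L.map fun d : ℕ => (2 : ℝ) ^ (-d : ℤ)).sum / 2 := by
      intro L
      induction L with
      | nil => simp
      | cons a L ih =>
        simp only [List.map_cons, List.sum_cons, ih]
        push_cast
        rw [neg_add, zpow_add₀ (by norm_num)]
        norm_num
        ring
    rw [leafDepths, h, List.map_append, List.sum_append, hl, hr]
    norm_num

namespace ReducedTreePair

/-- The depths of the `i`-th leaves of the two trees, for all `i`. -/
def depths (p : ReducedTreePair) : List (ℕ × ℕ) := (leafDepths p.source).zip (leafDepths p.target)

theorem plMap_depths_one (p : ReducedTreePair) : plMap p.depths 1 = 1 := by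
  have hl : (leafDepths p.source).length = (leafDepths p.target).length := by
    rw [length_leafDepths, length_leafDepths, p.numNodes_eq]
  have h1 : p.depths.map Prod.fst = leafDepths p.source := List.map_fst_zip hl.le
  have h2 : p.depths.map Prod.snd = leafDepths p.target := List.map_snd_zip hl.ge
  have h := plMap_sum p.depths
  have e1 := sum_leafDepths p.source
  have e2 := sum_leafDepths p.target
  rw [← h1, List.map_map] at e1
  rw [← h2, List.map_map] at e2
  simp only [Function.comp_def] at e1 e2
  rwa [e1, e2] at h

theorem plMap_swap_depths_one (p : ReducedTreePair) : plMap (p.depths.map Prod.swap) 1 = 1 := by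
  have := plMap_swap p.depths 1
  rwa [plMap_depths_one] at this

theorem plMap_mem {L : List (ℕ × ℕ)} (h : plMap L 1 = 1) (x : unitInterval) :
    plMap L x ∈ unitInterval := by
  have h0 := (plMap_strictMono L).monotone x.2.1
  have h1 := (plMap_strictMono L).monotone x.2.2
  rw [plMap_zero] at h0
  rw [h] at h1
  exact ⟨h0, h1⟩

/-- The homeomorphism of the unit interval represented by a tree pair. The leaves of a tree
correspond, from left to right, to consecutive intervals that subdivide `[0, 1]`, a leaf of depth
`d` to one of length `2 ^ (-d)`; the interval of each leaf of the source tree is mapped affinely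
onto the interval of the leaf of the target tree with the same number. -/
noncomputable def toOrderIso (p : ReducedTreePair) : unitInterval ≃o unitInterval where
  toFun x := ⟨plMap p.depths x, plMap_mem p.plMap_depths_one x⟩
  invFun x := ⟨plMap (p.depths.map Prod.swap) x, plMap_mem p.plMap_swap_depths_one x⟩
  left_inv x := Subtype.ext (plMap_swap p.depths x)
  right_inv x := Subtype.ext (by
    have := plMap_swap (p.depths.map Prod.swap) x
    rwa [List.map_map, Prod.swap_swap_eq, List.map_id] at this)
  map_rel_iff' := (plMap_strictMono p.depths).le_iff_le

theorem toOrderIso_mem (p : ReducedTreePair) : p.toOrderIso ∈ ThompsonF := by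
  obtain ⟨B, hBf, hBd, hB⟩ := plMap_local p.depths
  refine ⟨Subtype.val ⁻¹' B, hBf.preimage Subtype.val_injective.injOn, fun b hb => hBd b hb, ?_⟩
  intro x hx
  obtain ⟨m, q, hq, h⟩ := hB x hx
  exact ⟨m, q, hq, continuous_subtype_val.continuousAt.eventually h⟩

/-- The element of Thompson's group `F` represented by a reduced tree pair. -/
noncomputable def toF (p : ReducedTreePair) : ThompsonF := ⟨p.toOrderIso, p.toOrderIso_mem⟩

end ReducedTreePair

/-! ### Unordered tuples, the max stratification, and densities -/

/-- The sphere of radius `n` in the max stratification of the set of unordered `k`-tuples of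
reduced tree pairs: the tuples in which the maximal size of a component is `n`. -/
def sphMax (k n : ℕ) : Set (Sym ReducedTreePair k) :=
  {s | (∀ p ∈ s, p.size ≤ n) ∧ ∃ p ∈ s, p.size = n}

theorem sphMax_finite (k n : ℕ) : (sphMax k n).Finite := by
  have hfin : {p : ReducedTreePair | p.size ≤ n}.Finite := by
    let A : Set (BinaryTree Unit) := ⋃ i ∈ Set.Iic n, ↑(BinaryTree.treesOfNumNodesEq i)
    have hA : A.Finite := (Set.finite_Iic n).biUnion fun i _ => Finset.finite_toSet _
    refine ((hA.prod hA).preimage (f := fun p : ReducedTreePair => (p.source, p.target)) ?_).subset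
      ?_
    · rintro ⟨a, b, _, _, _⟩ - ⟨c, d, _, _, _⟩ - h
      obtain ⟨rfl, rfl⟩ := Prod.mk.inj h
      rfl
    · intro p hp
      have h1 : p.source.numNodes ≤ n := hp
      have h2 : p.target.numNodes ≤ n := p.numNodes_eq ▸ h1
      simp [A, h1, h2]
  have : Finite {p : ReducedTreePair // p.size ≤ n} := hfin
  have hs : Finite (Sym {p : ReducedTreePair // p.size ≤ n} k) := by
    have := Fintype.ofFinite {p : ReducedTreePair // p.size ≤ n}
    classical infer_instance
  refine (Set.finite_range (Sym.map (n := k) (Subtype.val :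
    {p : ReducedTreePair // p.size ≤ n} → ReducedTreePair))).subset ?_
  intro s hs
  refine ⟨s.attach.map fun p => ⟨p.1, hs.1 p.1 p.2⟩, ?_⟩
  rw [Sym.map_map]
  exact s.attach_map_coe

/-- The proportion of the elements of the `n`-sphere that lie in `T`. -/
noncomputable def sphereRatio {k : ℕ} (T : Set (Sym ReducedTreePair k)) (n : ℕ) : ℝ :=
  ((T ∩ sphMax k n).ncard : ℝ) / ((sphMax k n).ncard : ℝ)

/-- `T` has asymptotic density `d` with respect to the max stratification. -/
def HasDensity {k : ℕ} (T : Set (Sym ReducedTreePair k)) (d : ℝ) : Prop :=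
  Tendsto (sphereRatio T) atTop (𝓝 d)

/-- The lower asymptotic density of `T` with respect to the max stratification. It is the
asymptotic density of `T` whenever that exists. -/
noncomputable def lowerDensity {k : ℕ} (T : Set (Sym ReducedTreePair k)) : ℝ :=
  liminf (sphereRatio T) atTop

/-- The subgroup of `F` generated by an unordered tuple of reduced tree pairs. -/
def generatedSubgroup {k : ℕ} (s : Sym ReducedTreePair k) : Subgroup ThompsonF :=
  Subgroup.closure {f | ∃ p ∈ s, p.toF = f}

/-- The set of unordered `k`-tuples that generate a subgroup of `F` isomorphic to `H`. -/
def generatingTuples (k : ℕ) (H : Subgroup ThompsonF) : Set (Sym ReducedTreePair k) :=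
  {s | Nonempty (generatedSubgroup s ≃* H)}

/-- The `k`-subgroup spectrum of `F` with respect to the max stratification: the set of all
visible subgroups, that is, of those whose isomorphism class is generated by a set of `k`-tuples of
positive (lower) density. -/
def specMax (k : ℕ) : Set (Subgroup ThompsonF) :=
  {H | 0 < lowerDensity (generatingTuples k H)}

/-- `H` is persistent if it is visible among the `k`-generated subgroups for all large `k`. -/
def IsPersistent (H : Subgroup ThompsonF) : Prop := ∃ l : ℕ, ∀ k ≥ l, H ∈ specMax k

/-! ### Exposed carets and grafting -/

/-! Let r(n) be the number of pairs of trees with n carets and no common exposed caret, and write f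
⊕ g for the map acting as f on the left and as g on the right half of [0,1]. Two things are needed:
r(n+1)/r(n) is asymptotically at most μ, and there is a large explicit family of tuples that
generate a copy of F.

Growth. Removing common exposed carets, one leaf number at a time, gives a recursion
(`card_disjointPairs_succ`) that starts from the squares of the Catalan numbers. These are the
moments of a finite measure with variable t in [0,16], so r(n) is the integral of a polynomial
p_n(t) with p_{n+2} = t p_{n+1} - t p_n. The part with t < 4 is O(5^n), which is negligible because
the rest is at least c 6^n. For t ≥ 4 the p_n are positive and p_{n+1}/p_n is at most its value at t
= 16, which tends to the larger root μ = 8 + 4√3 of x² = 16x - 16. This yields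
`eventually_reducedCount_succ_le`.

Tuples. F is generated by x₀ and x₁ (`standardSubgroup_eq_thompsonF`), and the slopes at 0 and 1
provide the exponent sums a, b of F in these generators. For all f, g in F the map w ↦ w ⊕ (f^a(w) ⊕
g^b(w)) is an injective endomorphism. Its image is generated by x₀ ⊕ (f ⊕ 1) and x₁ ⊕ (1 ⊕ g), and
it already contains every (1 ⊕ (h ⊕ 1)) ⊕ 1, because both exponent sums of 1 ⊕ (h ⊕ 1) vanish
(`generatedSubgroup_eq_range`).

Here f, g, h are essentially arbitrary, and the three constructions add 4, 5 and 3 carets. Comparing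
with all tuples of the same maximal size costs a factor of about μ^4 for the component of maximal
size, μ^5 for the second one and μ^3 for each of the k - 2 others. -/

theorem mem_exposedCarets_node {l r : BinaryTree Unit} {i : ℕ} :
    i ∈ exposedCarets (.node () l r) ↔ (l = .nil ∧ r = .nil ∧ i = 0) ∨ i ∈ exposedCarets l ∨
      ∃ j ∈ exposedCarets r, l.numLeaves + j = i := by
  cases l <;> cases r <;> simp [exposedCarets]

theorem lt_of_mem_exposedCarets {T : BinaryTree Unit} {i : ℕ} (h : i ∈ exposedCarets T) :
    i < T.numNodes := by
  induction T generalizing i with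
  | nil => simp [exposedCarets] at h
  | node _ l r hl hr =>
    rw [mem_exposedCarets_node] at h
    rcases h with ⟨rfl, rfl, rfl⟩ | h | ⟨j, h, rfl⟩
    · simp
    · have := hl h
      simp only [BinaryTree.numNodes]
      lia
    · have := hr h
      simp only [BinaryTree.numNodes, BinaryTree.numLeaves_eq_numNodes_succ]
      lia

/-- Otherwise the leaf i + 1 would belong to two different carets. -/
theorem succ_notMem_exposedCarets {T : BinaryTree Unit} {i : ℕ} (h : i ∈ exposedCarets T) :
    i + 1 ∉ exposedCarets T := by
  induction T generalizing i with
  | nil => simp [exposedCarets] at h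
  | node _ l r hl hr =>
    intro h'
    rw [mem_exposedCarets_node] at h h'
    simp only [BinaryTree.numLeaves_eq_numNodes_succ] at h h'
    rcases h with ⟨rfl, rfl, rfl⟩ | h | ⟨j, h, rfl⟩
    · simp [exposedCarets] at h'
    · have h1 := lt_of_mem_exposedCarets h
      rcases h' with ⟨rfl, rfl, h'⟩ | h' | ⟨j, h', hj⟩
      · lia
      · exact hl h h'
      · lia
    · rcases h' with ⟨rfl, rfl, h'⟩ | h' | ⟨j', h', hj⟩
      · lia
      · have := lt_of_mem_exposedCarets h'
        lia
      · obtain rfl : j' = j + 1 := by lia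
        exact hr h h'

/-- Attach a caret to the leaf with number `j` of a tree. -/
def graftCaret : BinaryTree Unit → ℕ → BinaryTree Unit
  | .nil, _ => .node () .nil .nil
  | .node _ l r, j =>
    if j ≤ l.numNodes then .node () (graftCaret l j) r
    else .node () l (graftCaret r (j - (l.numNodes + 1)))

theorem numNodes_graftCaret (T : BinaryTree Unit) (j : ℕ) :
    (graftCaret T j).numNodes = T.numNodes + 1 := by
  induction T generalizing j with
  | nil => simp [graftCaret]
  | node _ l r hl hr =>
    rw [graftCaret]
    split_ifs
    · simp only [BinaryTree.numNodes, hl]; lia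
    · simp only [BinaryTree.numNodes, hr]; lia

theorem graftCaret_ne_nil (T : BinaryTree Unit) (j : ℕ) : graftCaret T j ≠ .nil := by
  intro h
  have := numNodes_graftCaret T j
  simp [h] at this

theorem mem_exposedCarets_graftCaret_self {T : BinaryTree Unit} {j : ℕ} (hj : j ≤ T.numNodes) :
    j ∈ exposedCarets (graftCaret T j) := by
  induction T generalizing j with
  | nil => simp_all [graftCaret, exposedCarets]
  | node _ l r hl hr =>
    rw [graftCaret]
    simp only [BinaryTree.numNodes] at hj
    split_ifs with h
    · exact mem_exposedCarets_node.2 (Or.inr (Or.inl (hl h)))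
    · refine mem_exposedCarets_node.2 (Or.inr (Or.inr ⟨_, hr (j := j - (l.numNodes + 1)) (by lia), ?_⟩))
      rw [BinaryTree.numLeaves_eq_numNodes_succ]
      lia

/-- Grafting at j renumbers only leaves to the right of j and can destroy only an exposed caret that
contains the leaf j. A caret on the leaves i, i + 1 with i + 1 < j is untouched. -/
theorem mem_exposedCarets_graftCaret {T : BinaryTree Unit} {i j : ℕ} (hj : j ≤ T.numNodes)
    (hi : i + 1 < j) : i ∈ exposedCarets (graftCaret T j) ↔ i ∈ exposedCarets T := by
  induction T generalizing i j with
  | nil =>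
    simp only [BinaryTree.numNodes] at hj
    lia
  | node _ l r hl hr =>
    rw [graftCaret]
    simp only [BinaryTree.numNodes] at hj
    split_ifs with h
    · rw [mem_exposedCarets_node, mem_exposedCarets_node, hl h hi]
      have h1 := graftCaret_ne_nil l j
      have h2 : l ≠ .nil := by
        rintro rfl
        simp at h
        lia
      simp only [h1, h2, false_and, false_or, BinaryTree.numLeaves_eq_numNodes_succ,
        numNodes_graftCaret]
      refine or_congr_right ⟨?_, ?_⟩ <;> rintro ⟨k, _, hk⟩ <;> lia
    · rw [mem_exposedCarets_node, mem_exposedCarets_node]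
      have h1 := graftCaret_ne_nil r (j - (l.numNodes + 1))
      simp only [h1, false_and, and_false, false_or, BinaryTree.numLeaves_eq_numNodes_succ]
      by_cases h3 : l = .nil ∧ r = .nil
      · obtain ⟨rfl, rfl⟩ := h3
        simp at hj
        lia
      · have h4 : ¬(l = .nil ∧ r = .nil ∧ i = 0) := fun h5 => h3 ⟨h5.1, h5.2.1⟩
        simp only [h4, false_or]
        refine or_congr_right (exists_congr fun k => and_congr_left fun hk => hr ?_ ?_) <;> lia

theorem graftCaret_injective {S T : BinaryTree Unit} {j : ℕ} (hS : j ≤ S.numNodes)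
    (hT : j ≤ T.numNodes) (h : graftCaret S j = graftCaret T j) : S = T := by
  have hn := congrArg BinaryTree.numNodes h
  rw [numNodes_graftCaret, numNodes_graftCaret] at hn
  induction S generalizing T j with
  | nil =>
    cases T with
    | nil => rfl
    | node => simp at hn
  | node _ l r hl hr =>
    cases T with
    | nil => simp at hn
    | node _ l' r' =>
      rw [graftCaret, graftCaret] at h
      simp only [BinaryTree.numNodes] at hS hT
      split_ifs at h with h1 h2 h2 <;> simp only [BinaryTree.node.injEq, true_and] at h
      · have := congrArg BinaryTree.numNodes h.1
        rw [numNodes_graftCaret, numNodes_graftCaret] at this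
        rw [hl h1 h2 h.1 this, h.2]
      · have := congrArg BinaryTree.numNodes h.1
        rw [numNodes_graftCaret] at this
        lia
      · have := congrArg BinaryTree.numNodes h.1
        rw [numNodes_graftCaret] at this
        lia
      · obtain ⟨rfl, h⟩ := h
        have := congrArg BinaryTree.numNodes h
        rw [numNodes_graftCaret, numNodes_graftCaret] at this
        rw [hr (by lia) (by lia) h this]

theorem exists_graftCaret_eq {T : BinaryTree Unit} {j : ℕ} (h : j ∈ exposedCarets T) :
    ∃ S : BinaryTree Unit, j ≤ S.numNodes ∧ graftCaret S j = T := by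
  induction T generalizing j with
  | nil => simp [exposedCarets] at h
  | node _ l r hl hr =>
    rw [mem_exposedCarets_node] at h
    rcases h with ⟨rfl, rfl, rfl⟩ | h | ⟨i, h, rfl⟩
    · exact ⟨.nil, by simp, by simp [graftCaret]⟩
    · obtain ⟨S, hS, rfl⟩ := hl h
      refine ⟨.node () S r, ?_, by rw [graftCaret, if_pos hS]⟩
      simp only [BinaryTree.numNodes]
      lia
    · obtain ⟨S, hS, rfl⟩ := hr h
      refine ⟨.node () l S, ?_, ?_⟩
      · simp only [BinaryTree.numNodes, BinaryTree.numLeaves_eq_numNodes_succ]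
        lia
      · rw [graftCaret, if_neg (by rw [BinaryTree.numLeaves_eq_numNodes_succ]; lia),
          BinaryTree.numLeaves_eq_numNodes_succ, Nat.add_sub_cancel_left]

/-! ### Counting pairs without common exposed carets -/

/-- The pairs of trees with `n` carets that have no exposed caret with a leaf number below `m` in
common. -/
def disjointPairs (n m : ℕ) : Finset (BinaryTree Unit × BinaryTree Unit) :=
  (BinaryTree.treesOfNumNodesEq n ×ˢ BinaryTree.treesOfNumNodesEq n).filter fun p =>
    ∀ i < m, ¬(i ∈ exposedCarets p.1 ∧ i ∈ exposedCarets p.2)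

theorem mem_disjointPairs {n m : ℕ} {p : BinaryTree Unit × BinaryTree Unit} :
    p ∈ disjointPairs n m ↔ (p.1.numNodes = n ∧ p.2.numNodes = n) ∧
      ∀ i < m, ¬(i ∈ exposedCarets p.1 ∧ i ∈ exposedCarets p.2) := by
  simp [disjointPairs]

theorem mem_disjointPairs_self {n : ℕ} {p : BinaryTree Unit × BinaryTree Unit} :
    p ∈ disjointPairs n n ↔ (p.1.numNodes = n ∧ p.2.numNodes = n) ∧
      Disjoint (exposedCarets p.1) (exposedCarets p.2) := by
  rw [mem_disjointPairs, Finset.disjoint_left]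
  refine and_congr_right fun h => ⟨fun h' i hi hi' => h' i ?_ ⟨hi, hi'⟩,
    fun h' i _ hi => h' hi.1 hi.2⟩
  exact h.1 ▸ lt_of_mem_exposedCarets hi

theorem card_disjointPairs_zero (n : ℕ) : (disjointPairs n 0).card = catalan n ^ 2 := by
  simp [disjointPairs, BinaryTree.treesOfNumNodesEq_card_eq_catalan, sq]

/-- The pairs lost when m is also forbidden are those with a common exposed caret at m, and they
arise by grafting a caret at the leaf m of both trees of a smaller pair. The smaller pair need only
satisfy the condition below m - 1, since the grafted carets rule out an exposed caret at m - 1. For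
m = 0 the truncated subtraction correctly imposes no condition. -/
theorem card_disjointPairs_succ {n m : ℕ} (hm : m ≤ n) :
    (disjointPairs (n + 1) (m + 1)).card + (disjointPairs n (m - 1)).card =
      (disjointPairs (n + 1) m).card := by
  classical
  have h := Finset.card_filter_add_card_filter_not (s := disjointPairs (n + 1) m)
    (fun p => ¬(m ∈ exposedCarets p.1 ∧ m ∈ exposedCarets p.2))
  rw [← h]
  congr 1
  · congr 1
    ext p
    simp only [mem_disjointPairs, Finset.mem_filter, Nat.lt_succ_iff_lt_or_eq, or_imp, forall_and,
      forall_eq]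
    tauto
  · refine Finset.card_bij (fun p _ => (graftCaret p.1 m, graftCaret p.2 m)) ?_ ?_ ?_
    · rintro ⟨S, T⟩ hp
      rw [mem_disjointPairs] at hp
      obtain ⟨⟨h1, h2⟩, h3⟩ := hp
      simp only at h1 h2 h3
      have e1 := mem_exposedCarets_graftCaret_self (T := S) (j := m) (by lia)
      have e2 := mem_exposedCarets_graftCaret_self (T := T) (j := m) (by lia)
      simp only [mem_disjointPairs, Finset.mem_filter, numNodes_graftCaret, h1, h2, not_not, e1, e2,
        and_self, and_true, true_and]
      rintro i hi ⟨hS, hT⟩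
      -- The number m - 1 comes for free from the neighbouring grafted caret; smaller numbers are
      -- unaffected by the grafting.
      rcases eq_or_ne (i + 1) m with rfl | h4
      · exact succ_notMem_exposedCarets hS e1
      · rw [mem_exposedCarets_graftCaret (by lia) (by lia)] at hS hT
        exact h3 i (by lia) ⟨hS, hT⟩
    · rintro ⟨S, T⟩ hp ⟨S', T'⟩ hp' he
      simp only [mem_disjointPairs] at hp hp'
      simp only [Prod.mk.injEq] at he
      rw [graftCaret_injective (by lia) (by lia) he.1, graftCaret_injective (by lia) (by lia) he.2]
    · rintro ⟨S, T⟩ hp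
      simp only [mem_disjointPairs, Finset.mem_filter, not_not] at hp
      obtain ⟨⟨⟨h1, h2⟩, h3⟩, h4, h5⟩ := hp
      obtain ⟨S, hS, rfl⟩ := exists_graftCaret_eq h4
      obtain ⟨T, hT, rfl⟩ := exists_graftCaret_eq h5
      rw [numNodes_graftCaret, Nat.add_right_cancel_iff] at h1 h2
      refine ⟨(S, T), mem_disjointPairs.2 ⟨⟨h1, h2⟩, fun i hi h6 => h3 i (by lia) ?_⟩, rfl⟩
      rwa [mem_exposedCarets_graftCaret hS (by lia), mem_exposedCarets_graftCaret hT (by lia)]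

/-- The polynomials whose `n`-th member becomes the number of reduced pairs of trees with `n`
carets when each power `t ^ m` is replaced by the square of a Catalan number. -/
noncomputable def pairPoly : ℕ → ℝ → ℝ
  | 0, _ => 1
  | 1, t => t - 1
  | n + 2, t => t * pairPoly (n + 1) t - t * pairPoly n t

theorem continuous_pairPoly (n : ℕ) : Continuous (pairPoly n) := by
  suffices h : Continuous (pairPoly n) ∧ Continuous (pairPoly (n + 1)) from h.1
  induction n with
  | zero => exact ⟨continuous_const, continuous_id.sub continuous_const⟩
  | succ n ih => exact ⟨ih.2, (continuous_id.mul ih.2).sub (continuous_id.mul ih.1)⟩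

/-- The number of pairs of trees with `n` carets without common exposed caret. -/
def reducedCount (n : ℕ) : ℕ := (disjointPairs n n).card

/-! ### Squares of Catalan numbers as moments -/

section Moments

open MeasureTheory Real

/-- With cos² = 1 - sin² this is a difference of two Wallis integrals. The Catalan numbers thus
become moments of the variable 4 sin² θ, which ranges over [0,4]. -/
theorem catalan_eq_integral (m : ℕ) :
    ∫ θ in 0..π, (4 * sin θ ^ 2) ^ m * (2 / π * cos θ ^ 2) = (catalan m : ℝ) := by
  have h1 : ∀ θ : ℝ, (4 * sin θ ^ 2) ^ m * (2 / π * cos θ ^ 2) =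
      2 * 4 ^ m / π * (sin θ ^ (2 * m) - sin θ ^ (2 * m + 2)) := by
    intro θ
    rw [cos_sq', mul_pow, ← pow_mul]
    ring
  have h2 : ∀ m : ℕ, ∫ θ in 0..π, sin θ ^ (2 * m) = π * m.centralBinom / 4 ^ m := by
    intro m
    induction m with
    | zero => simp
    | succ m ih =>
      rw [mul_add_one, integral_sin_pow, ih]
      have := Nat.succ_mul_centralBinom_succ m
      have h3 : ((m : ℝ) + 1) * (m + 1).centralBinom = 2 * (2 * m + 1) * m.centralBinom := by
        exact_mod_cast this
      simp
      field_simp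
      linear_combination (-2 * 4 ^ m : ℝ) * h3
  simp_rw [h1]
  rw [intervalIntegral.integral_const_mul, intervalIntegral.integral_sub
    (by apply Continuous.intervalIntegrable; fun_prop)
    (by apply Continuous.intervalIntegrable; fun_prop), integral_sin_pow, h2]
  have h4 : ((m : ℝ) + 1) * catalan m = m.centralBinom := by
    exact_mod_cast succ_mul_catalan_eq_centralBinom m
  rw [← h4]
  simp
  field_simp
  ring

/-- Moments of a product of independent variables multiply, so two independent copies of the
variable whose moments are the Catalan numbers suffice. -/
theorem exists_measure_catalan_sq : ∃ (ν : Measure (ℝ × ℝ)) (t : ℝ × ℝ → ℝ), IsFiniteMeasure ν ∧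
    Measurable t ∧ (∀ x, t x ∈ Set.Icc 0 16) ∧ ∀ m : ℕ, ∫ x, t x ^ m ∂ν = (catalan m : ℝ) ^ 2 := by
  let w : ℝ → NNReal := fun θ => Real.toNNReal (2 / π * cos θ ^ 2)
  have hw : Measurable w := by
    refine Measurable.real_toNNReal ?_
    fun_prop
  let ρ : Measure ℝ := (volume.restrict (Set.Ioc 0 π)).withDensity fun θ => w θ
  have hρ : ∀ m : ℕ, ∫ θ, (4 * sin θ ^ 2) ^ m ∂ρ = (catalan m : ℝ) := by
    intro m
    rw [integral_withDensity_eq_integral_smul hw, ← catalan_eq_integral,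
      intervalIntegral.integral_of_le pi_pos.le]
    refine integral_congr_ae (Eventually.of_forall fun θ => ?_)
    change (w θ : ℝ) * _ = _
    rw [Real.coe_toNNReal _ (by positivity), mul_comm]
  have hfin : IsFiniteMeasure ρ := by
    refine isFiniteMeasure_withDensity_ofReal ?_
    refine Integrable.hasFiniteIntegral ?_
    refine IntegrableOn.mono_set (t := Set.Icc 0 π) (Continuous.integrableOn_Icc ?_)
      Set.Ioc_subset_Icc_self
    fun_prop
  refine ⟨ρ.prod ρ, fun x => (4 * sin x.1 ^ 2) * (4 * sin x.2 ^ 2), inferInstance, by fun_prop,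
    fun x => ?_, fun m => ?_⟩
  · have h1 := sin_sq_le_one x.1
    have h2 := sin_sq_le_one x.2
    constructor
    · positivity
    · nlinarith [sq_nonneg (sin x.1), sq_nonneg (sin x.2)]
  · simp_rw [mul_pow (4 * sin _ ^ 2) (4 * sin _ ^ 2) m]
    rw [integral_prod_mul (fun θ => (4 * sin θ ^ 2) ^ m) (fun θ => (4 * sin θ ^ 2) ^ m), hρ, sq]

variable {X : Type*} [MeasurableSpace X] {ν : Measure X} [IsFiniteMeasure ν] {t : X → ℝ}

theorem integrable_continuous_comp (ht : Measurable t) (ht' : ∀ x, t x ∈ Set.Icc 0 16) {f : ℝ → ℝ}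
    (hf : Continuous f) : Integrable (fun x => f (t x)) ν := by
  obtain ⟨C, hC⟩ := isCompact_Icc.exists_bound_of_continuousOn (s := Set.Icc (0 : ℝ) 16)
    hf.continuousOn
  exact Integrable.of_bound (hf.measurable.comp ht).aestronglyMeasurable C
    (Eventually.of_forall fun x => hC _ (ht' x))

/-- The recursion for the counts is linear. Under integration, passing from n to n - 1 carets lowers
the power of t, and the recursion turns into the one that defines `pairPoly`. -/
theorem card_disjointPairs_eq_integral (ht : Measurable t) (ht' : ∀ x, t x ∈ Set.Icc 0 16)
    (hν : ∀ m : ℕ, ∫ x, t x ^ m ∂ν = (catalan m : ℝ) ^ 2) (m : ℕ) : ∀ n, m ≤ n →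
    ((disjointPairs n m).card : ℝ) = ∫ x, t x ^ (n - m) * pairPoly m (t x) ∂ν := by
  have hi : ∀ j m : ℕ, Integrable (fun x => t x ^ j * pairPoly m (t x)) ν := fun j m =>
    integrable_continuous_comp ht ht' ((continuous_id.pow j).mul (continuous_pairPoly m))
  induction m using Nat.twoStepInduction with
  | zero =>
    intro n _
    simp [card_disjointPairs_zero, pairPoly, hν]
  | one =>
    intro n hn
    obtain ⟨n, rfl⟩ := Nat.exists_eq_add_of_le' hn
    have h := card_disjointPairs_succ (n := n) (m := 0) (Nat.zero_le n)
    -- At m = 0 the truncated m - 1 is 0, which is why `pairPoly 1` is t - 1 and does not follow the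
    -- general recursion.
    simp only [Nat.zero_sub, card_disjointPairs_zero, zero_add] at h
    have h1 : ∀ x, t x ^ (n + 1 - 1) * pairPoly 1 (t x) = t x ^ (n + 1) - t x ^ n := by
      intro x
      simp only [pairPoly, Nat.add_sub_cancel]
      ring
    simp_rw [h1]
    rw [integral_sub (integrable_continuous_comp ht ht' (continuous_pow _))
      (integrable_continuous_comp ht ht' (continuous_pow _)), hν, hν, eq_sub_iff_add_eq]
    exact_mod_cast h
  | more m ih1 ih2 =>
    intro n hn
    obtain ⟨j, rfl⟩ := Nat.exists_eq_add_of_le' hn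
    have h := card_disjointPairs_succ (n := j + m + 1) (m := m + 1) (by lia)
    have h' : ((disjointPairs (j + m + 1 + 1) (m + 1 + 1)).card : ℝ) =
        (disjointPairs (j + m + 1 + 1) (m + 1)).card - (disjointPairs (j + m + 1) m).card := by
      rw [eq_sub_iff_add_eq]
      exact_mod_cast h
    rw [show j + (m + 2) = j + m + 1 + 1 by ring, h', ih1 _ (by lia), ih2 _ (by lia),
      ← integral_sub (hi _ _) (hi _ _)]
    refine integral_congr_ae (Eventually.of_forall fun x => ?_)
    rw [show j + m + 1 + 1 - (m + 1) = j + 1 by lia, show j + m + 1 - m = j + 1 by lia,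
      show j + m + 1 + 1 - (m + 2) = j by lia]
    simp only [pairPoly]
    ring

theorem reducedCount_eq_integral (ht : Measurable t) (ht' : ∀ x, t x ∈ Set.Icc 0 16)
    (hν : ∀ m : ℕ, ∫ x, t x ^ m ∂ν = (catalan m : ℝ) ^ 2) (n : ℕ) :
    (reducedCount n : ℝ) = ∫ x, pairPoly n (t x) ∂ν := by
  rw [reducedCount, card_disjointPairs_eq_integral ht ht' hν n n le_rfl]
  simp

end Moments

/-! ### Growth of the number of reduced pairs -/

/-- The triangle inequality in the recursion closes because 4 · 5 + 4 ≤ 5². The crude base 5 is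
enough, being below the base 6 of the main term. -/
theorem abs_pairPoly_le_pow {t : ℝ} (h0 : 0 ≤ t) (h4 : t ≤ 4) (n : ℕ) : |pairPoly n t| ≤ 5 ^ n := by
  induction n using Nat.twoStepInduction with
  | zero => simp [pairPoly]
  | one => simp only [pairPoly, pow_one, abs_le]; constructor <;> linarith
  | more n ih1 ih2 =>
    have h1 : |pairPoly (n + 2) t| ≤ t * |pairPoly (n + 1) t| + t * |pairPoly n t| := by
      rw [pairPoly]
      refine (abs_sub _ _).trans ?_
      rw [abs_mul, abs_mul, abs_of_nonneg h0]
    have h2 := mul_le_mul h4 ih1 (abs_nonneg _) (by norm_num)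
    have h3 := mul_le_mul h4 ih2 (abs_nonneg _) (by norm_num)
    have h5 : (0 : ℝ) < 5 ^ n := by positivity
    rw [pow_succ] at h3
    rw [pow_succ, pow_succ]
    linarith

/-- The second hypothesis says that c lies between the roots of x² - tx + t, the characteristic
polynomial of the recursion. Then a quotient of consecutive values that is at least c stays so: t -
t/c ≥ c. Later uses take c = 2 for t ≥ 4 and c = 6 for t ≥ 8. -/
theorem pairPoly_growth {t c : ℝ} (hc : 1 ≤ c) (ht : c * c ≤ t * (c - 1)) (n : ℕ) :
    0 < pairPoly n t ∧ c * pairPoly n t ≤ pairPoly (n + 1) t := by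
  have hc1 : c ≠ 1 := by
    rintro rfl
    linarith
  have hc1 : 0 < c - 1 := by
    rw [sub_pos]
    exact lt_of_le_of_ne hc hc1.symm
  have ht0 : c + 1 ≤ t := by
    by_contra! h
    nlinarith
  induction n with
  | zero =>
    simp only [pairPoly]
    constructor <;> linarith
  | succ n ih =>
    have h1 : 0 < pairPoly (n + 1) t := lt_of_lt_of_le (mul_pos (by linarith) ih.1) ih.2
    refine ⟨h1, ?_⟩
    rw [pairPoly]
    have h2 : c * (t * pairPoly n t) ≤ t * pairPoly (n + 1) t := by
      nlinarith [mul_le_mul_of_nonneg_left ih.2 (by linarith : 0 ≤ t)]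
    have h3 := mul_le_mul_of_nonneg_right ht h1.le
    have h4 : c * (c * pairPoly (n + 1) t) ≤
        c * (t * pairPoly (n + 1) t - t * pairPoly n t) := by linarith
    exact le_of_mul_le_mul_left h4 (by linarith)

theorem pow_le_pairPoly {t c : ℝ} (hc : 1 ≤ c) (ht : c * c ≤ t * (c - 1)) (n : ℕ) :
    c ^ n ≤ pairPoly n t := by
  induction n with
  | zero => simp [pairPoly]
  | succ n ih =>
    rw [pow_succ']
    exact (mul_le_mul_of_nonneg_left ih (by linarith)).trans (pairPoly_growth hc ht n).2

/-- The quotients of consecutive values of `pairPoly` at `16`. -/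
noncomputable def ratioBound : ℕ → ℝ
  | 0 => 15
  | n + 1 => 16 - 16 / ratioBound n

/-- The map x ↦ 16 - 16/x has the fixed points 8 ± 4√3, and near the larger one it contracts by a
factor of at most 1/2. -/
theorem ratioBound_sub_bounds (n : ℕ) : 0 ≤ ratioBound n - (8 + 4 * √3) ∧
    ratioBound n - (8 + 4 * √3) ≤ (1 / 2) ^ n := by
  have h3 : √3 ^ 2 = 3 := Real.sq_sqrt (by norm_num)
  have h1 : (1.7 : ℝ) ≤ √3 := Real.le_sqrt_of_sq_le (by norm_num)
  have h2 : √3 ≤ 1.75 := Real.sqrt_le_iff.2 (by norm_num)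
  induction n with
  | zero => simp only [ratioBound]; constructor <;> norm_num <;> linarith
  | succ n ih =>
    have h4 : 14 ≤ ratioBound n := by linarith [ih.1]
    -- The two fixed points have sum 16 and product 16.
    have h5 : ratioBound (n + 1) - (8 + 4 * √3) =
        (8 - 4 * √3) / ratioBound n * (ratioBound n - (8 + 4 * √3)) := by
      rw [ratioBound]
      field_simp
      linear_combination (-16 : ℝ) * h3
    have h6 : (8 - 4 * √3) / ratioBound n ≤ 1 / 2 := by
      rw [div_le_div_iff₀ (by linarith) (by norm_num)]
      linarith
    have h7 : 0 ≤ (8 - 4 * √3) / ratioBound n := div_nonneg (by linarith) (by linarith)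
    rw [h5, pow_succ']
    exact ⟨mul_nonneg h7 ih.1, mul_le_mul h6 ih.2 ih.1 (by norm_num)⟩

theorem tendsto_ratioBound : Tendsto ratioBound atTop (𝓝 (8 + 4 * √3)) := by
  rw [← tendsto_sub_nhds_zero_iff]
  exact squeeze_zero (fun n => (ratioBound_sub_bounds n).1) (fun n => (ratioBound_sub_bounds n).2)
    (tendsto_pow_atTop_nhds_zero_of_lt_one (by norm_num) (by norm_num))

/-- The quotients of consecutive values obey x ↦ t - t/x, which increases in x and, for x ≥ 1, in t.
Hence the value at t = 16 dominates. -/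
theorem pairPoly_succ_le {t : ℝ} (h4 : 4 ≤ t) (h16 : t ≤ 16) (n : ℕ) :
    pairPoly (n + 1) t ≤ ratioBound n * pairPoly n t := by
  induction n with
  | zero => simp only [pairPoly, ratioBound]; linarith
  | succ n ih =>
    have h3 : 0 ≤ √3 := Real.sqrt_nonneg 3
    have hr := (ratioBound_sub_bounds n).1
    have hr' : 0 < ratioBound n := by linarith
    have hg := pairPoly_growth (c := 2) (t := t) (by norm_num) (by linarith) n
    have h1 : pairPoly (n + 1) t / ratioBound n ≤ pairPoly n t := by
      rw [div_le_iff₀ hr']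
      linarith
    rw [pairPoly, ratioBound]
    have h5 : 0 ≤ pairPoly (n + 1) t - pairPoly (n + 1) t / ratioBound n := by linarith
    calc t * pairPoly (n + 1) t - t * pairPoly n t
        ≤ t * (pairPoly (n + 1) t - pairPoly (n + 1) t / ratioBound n) := by
          nlinarith [mul_le_mul_of_nonneg_left h1 (by linarith : 0 ≤ t)]
      _ ≤ 16 * (pairPoly (n + 1) t - pairPoly (n + 1) t / ratioBound n) :=
          mul_le_mul_of_nonneg_right h16 h5
      _ = _ := by ring

section Growth

open MeasureTheory

/-- Here a(n) and b(n) are the integrals of p_n over {t ≥ 4} and its complement, and c is the mass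
of {t ≥ 8}. -/
theorem exists_reducedCount_split : ∃ (a b : ℕ → ℝ) (C c : ℝ), 0 < c ∧
    (∀ n, (reducedCount n : ℝ) = a n + b n) ∧ (∀ n, |b n| ≤ C * 5 ^ n) ∧
    (∀ n, c * 6 ^ n ≤ a n) ∧ ∀ n, a (n + 1) ≤ ratioBound n * a n := by
  obtain ⟨ν, t, hfin, ht, ht', hν⟩ := exists_measure_catalan_sq
  let A : Set (ℝ × ℝ) := {x | 4 ≤ t x}
  let B : Set (ℝ × ℝ) := {x | 8 ≤ t x}
  have hA : MeasurableSet A := measurableSet_le measurable_const ht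
  have hB : MeasurableSet B := measurableSet_le measurable_const ht
  have hBA : B ⊆ A := fun x (hx : 8 ≤ t x) => show 4 ≤ t x by linarith
  have hi : ∀ n, Integrable (fun x => pairPoly n (t x)) ν := fun n =>
    integrable_continuous_comp ht ht' (continuous_pairPoly n)
  refine ⟨fun n => ∫ x in A, pairPoly n (t x) ∂ν, fun n => ∫ x in Aᶜ, pairPoly n (t x) ∂ν,
    ν.real Set.univ, ν.real B, ?_, ?_, ?_, ?_, ?_⟩
  · by_contra! h
    have h0 : ν B = 0 := by
      have := le_antisymm h measureReal_nonneg
      rwa [measureReal_eq_zero_iff] at this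
    -- If t were almost surely below 8, the moments would be at most 8^m. The exponent 13 is the
    -- first positive one with catalan(m)² > 8^m.
    have h1 : ∫ x, t x ^ 13 ∂ν ≤ ∫ _, (8 : ℝ) ^ 13 ∂ν := by
      refine integral_mono_ae (integrable_continuous_comp ht ht' (continuous_id.pow 13))
        (integrable_const _) ?_
      filter_upwards [measure_eq_zero_iff_ae_notMem.1 h0] with x hx
      exact pow_le_pow_left₀ (ht' x).1 (not_le.1 (show ¬8 ≤ t x from hx)).le 13
    have h2 := hν 0
    simp only [pow_zero, catalan_zero, Nat.cast_one, one_pow, integral_const, smul_eq_mul,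
      mul_one] at h2
    have h3 : catalan 13 = 742900 := by
      rw [catalan_eq_centralBinom_div]
      decide
    rw [hν, h3, integral_const, h2, smul_eq_mul] at h1
    norm_num at h1
  · intro n
    rw [reducedCount_eq_integral ht ht' hν, integral_add_compl hA (hi n)]
  · intro n
    have h1 : ‖∫ x in Aᶜ, pairPoly n (t x) ∂ν‖ ≤ 5 ^ n * ν.real Aᶜ := by
      refine norm_setIntegral_le_of_norm_le_const (measure_lt_top _ _) fun x hx => ?_
      exact abs_pairPoly_le_pow (ht' x).1 (not_le.1 (show ¬4 ≤ t x from hx)).le n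
    refine h1.trans ?_
    rw [mul_comm]
    exact mul_le_mul_of_nonneg_right (measureReal_mono (Set.subset_univ _)) (by positivity)
  · intro n
    calc ν.real B * 6 ^ n = ∫ _ in B, (6 : ℝ) ^ n ∂ν := by
          rw [setIntegral_const, smul_eq_mul]
      _ ≤ ∫ x in B, pairPoly n (t x) ∂ν := by
          refine setIntegral_mono_on (integrable_const _).integrableOn (hi n).integrableOn hB ?_
          intro x (hx : 8 ≤ t x)
          exact pow_le_pairPoly (by norm_num) (by linarith) n
      _ ≤ _ := by
          refine setIntegral_mono_set (hi n).integrableOn ?_ hBA.eventuallyLE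
          rw [EventuallyLE, ae_restrict_iff' hA]
          refine Eventually.of_forall fun x (hx : 4 ≤ t x) => ?_
          exact (pairPoly_growth (c := 2) (by norm_num) (by linarith) n).1.le
  · intro n
    rw [← integral_const_mul]
    refine setIntegral_mono_on (hi _).integrableOn ((hi n).const_mul _).integrableOn hA ?_
    intro x hx
    exact pairPoly_succ_le hx (ht' x).2 n

end Growth

theorem exists_le_reducedCount : ∃ c : ℝ, 0 < c ∧ ∀ᶠ n in atTop, c * 6 ^ n ≤ reducedCount n := by
  obtain ⟨a, b, C, c, hc, hab, hb, ha, -⟩ := exists_reducedCount_split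
  refine ⟨c / 2, by positivity, ?_⟩
  have h1 : Tendsto (fun n : ℕ => C * (5 / 6 : ℝ) ^ n) atTop (𝓝 (C * 0)) :=
    (tendsto_pow_atTop_nhds_zero_of_lt_one (by norm_num) (by norm_num)).const_mul C
  rw [mul_zero] at h1
  filter_upwards [h1.eventually_le_const (show 0 < c / 2 by positivity)] with n hn
  have h2 := abs_le.1 (hb n)
  have h3 := ha n
  have h4 : C * 5 ^ n ≤ c / 2 * 6 ^ n := by
    have := mul_le_mul_of_nonneg_right hn (show (0 : ℝ) ≤ 6 ^ n by positivity)
    rw [div_pow] at this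
    field_simp at this ⊢
    linarith
  rw [hab]
  linarith

theorem tendsto_reducedCount_atTop : Tendsto (fun n => (reducedCount n : ℝ)) atTop atTop := by
  obtain ⟨c, hc, h⟩ := exists_le_reducedCount
  exact tendsto_atTop_mono' _ h
    ((tendsto_pow_atTop_atTop_of_one_lt (by norm_num)).const_mul_atTop hc)

/-- The main part grows by at most a factor l' < l for large n. The error terms of order 5^n are
absorbed by (l - l') r(n), which has order at least 6^n. -/
theorem eventually_reducedCount_succ_le {l : ℝ} (hl : 8 + 4 * √3 < l) :
    ∀ᶠ n in atTop, (reducedCount (n + 1) : ℝ) ≤ l * reducedCount n := by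
  obtain ⟨c, hc, hc'⟩ := exists_le_reducedCount
  obtain ⟨a, b, C, -, -, hab, hb, -, hr⟩ := exists_reducedCount_split
  obtain ⟨l', hl', hl''⟩ := exists_between hl
  have h1 : Tendsto (fun n : ℕ => (C * 5 + l' * C) * (5 / 6 : ℝ) ^ n) atTop
      (𝓝 ((C * 5 + l' * C) * 0)) :=
    (tendsto_pow_atTop_nhds_zero_of_lt_one (by norm_num) (by norm_num)).const_mul _
  rw [mul_zero] at h1
  have h3 : 0 ≤ √3 := Real.sqrt_nonneg 3
  filter_upwards [hc', tendsto_ratioBound.eventually_le_const hl',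
    h1.eventually_le_const (show 0 < (l - l') * c from mul_pos (by linarith) hc)] with n h4 h5 h6
  have h7 := abs_le.1 (hb n)
  have h8 := abs_le.1 (hb (n + 1))
  have h9 : (C * 5 + l' * C) * 5 ^ n ≤ (l - l') * c * 6 ^ n := by
    have := mul_le_mul_of_nonneg_right h6 (show (0 : ℝ) ≤ 6 ^ n by positivity)
    rw [div_pow] at this
    field_simp at this ⊢
    linarith
  have h10 : (l - l') * (c * 6 ^ n) ≤ (l - l') * reducedCount n :=
    mul_le_mul_of_nonneg_left h4 (by linarith)
  have h11 : a (n + 1) ≤ l' * (reducedCount n + C * 5 ^ n) := by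
    have hr0 : 0 ≤ ratioBound n := by linarith [(ratioBound_sub_bounds n).1]
    calc a (n + 1) ≤ ratioBound n * a n := hr n
      _ ≤ ratioBound n * (reducedCount n + C * 5 ^ n) :=
          mul_le_mul_of_nonneg_left (by rw [hab]; linarith) hr0
      _ ≤ _ := by
          refine mul_le_mul_of_nonneg_right h5 ?_
          have : 0 ≤ C * 5 ^ n := (abs_nonneg _).trans (hb n)
          positivity
  rw [hab (n + 1)]
  rw [pow_succ] at h8
  linarith

/-! ### Juxtaposition of homeomorphisms of the unit interval -/

section Juxtapose

/-- The map that acts as `f` on the left and as `g` on the right half of the unit interval. -/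
noncomputable def juxtaposeFun (f g : unitInterval ≃o unitInterval) (x : unitInterval) :
    unitInterval :=
  ⟨((f (Set.projIcc 0 1 zero_le_one (2 * (x : ℝ))) : ℝ) +
      g (Set.projIcc 0 1 zero_le_one (2 * (x : ℝ) - 1))) / 2, by
    constructor
    · have h1 := (f (Set.projIcc 0 1 zero_le_one (2 * (x : ℝ)))).2.1
      have h2 := (g (Set.projIcc 0 1 zero_le_one (2 * (x : ℝ) - 1))).2.1
      linarith
    · have h1 := (f (Set.projIcc 0 1 zero_le_one (2 * (x : ℝ)))).2.2
      have h2 := (g (Set.projIcc 0 1 zero_le_one (2 * (x : ℝ) - 1))).2.2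
      linarith⟩

theorem OrderIso.unitInterval_map_zero (f : unitInterval ≃o unitInterval) : f 0 = 0 := f.map_bot

theorem OrderIso.unitInterval_map_one (f : unitInterval ≃o unitInterval) : f 1 = 1 := f.map_top

theorem projIcc_of_le_zero {x : ℝ} (h : x ≤ 0) :
    Set.projIcc (0 : ℝ) 1 zero_le_one x = (0 : unitInterval) := Set.projIcc_of_le_left _ h

theorem projIcc_of_one_le {x : ℝ} (h : 1 ≤ x) :
    Set.projIcc (0 : ℝ) 1 zero_le_one x = (1 : unitInterval) := Set.projIcc_of_right_le _ h

theorem juxtaposeFun_val (f g : unitInterval ≃o unitInterval) (x : unitInterval) :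
    (juxtaposeFun f g x : ℝ) = ((f (Set.projIcc 0 1 zero_le_one (2 * (x : ℝ))) : ℝ) +
      g (Set.projIcc 0 1 zero_le_one (2 * (x : ℝ) - 1))) / 2 := rfl

theorem juxtaposeFun_of_le (f g : unitInterval ≃o unitInterval) {x : unitInterval}
    (h : (x : ℝ) ≤ 1 / 2) :
    (juxtaposeFun f g x : ℝ) = f (Set.projIcc 0 1 zero_le_one (2 * (x : ℝ))) / 2 := by
  rw [juxtaposeFun_val, projIcc_of_le_zero (x := 2 * (x : ℝ) - 1) (by linarith),
    g.unitInterval_map_zero]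
  simp

theorem juxtaposeFun_of_ge (f g : unitInterval ≃o unitInterval) {x : unitInterval}
    (h : 1 / 2 ≤ (x : ℝ)) :
    (juxtaposeFun f g x : ℝ) = (1 + g (Set.projIcc 0 1 zero_le_one (2 * (x : ℝ) - 1))) / 2 := by
  rw [juxtaposeFun_val, projIcc_of_one_le (x := 2 * (x : ℝ)) (by linarith), f.unitInterval_map_one]
  simp

theorem juxtaposeFun_comp (f g f' g' : unitInterval ≃o unitInterval) (x : unitInterval) :
    juxtaposeFun f g (juxtaposeFun f' g' x) = juxtaposeFun (f * f') (g * g') x := by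
  apply Subtype.ext
  rcases le_total (x : ℝ) (1 / 2) with h | h
  · have h1 := juxtaposeFun_of_le f' g' h
    have h2 := (f' (Set.projIcc 0 1 zero_le_one (2 * (x : ℝ)))).2.2
    rw [juxtaposeFun_of_le f g (by linarith), h1, juxtaposeFun_of_le _ _ h, mul_div_cancel₀ _
      two_ne_zero, Set.projIcc_val]
    rfl
  · have h1 := juxtaposeFun_of_ge f' g' h
    have h2 := (g' (Set.projIcc 0 1 zero_le_one (2 * (x : ℝ) - 1))).2.1
    rw [juxtaposeFun_of_ge f g (by linarith), h1, juxtaposeFun_of_ge _ _ h, mul_div_cancel₀ _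
      two_ne_zero, add_sub_cancel_left, Set.projIcc_val]
    rfl

theorem juxtaposeFun_one (x : unitInterval) : juxtaposeFun 1 1 x = x := by
  apply Subtype.ext
  have h0 := x.2.1
  have h1 := x.2.2
  rcases le_total (x : ℝ) (1 / 2) with h | h
  · rw [juxtaposeFun_of_le _ _ h, RelIso.one_apply,
      Set.projIcc_of_mem zero_le_one ⟨by linarith, by linarith⟩]
    simp
  · rw [juxtaposeFun_of_ge _ _ h, RelIso.one_apply,
      Set.projIcc_of_mem zero_le_one ⟨by linarith, by linarith⟩]
    simp

theorem juxtaposeFun_mono (f g : unitInterval ≃o unitInterval) : Monotone (juxtaposeFun f g) := by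
  intro x y h
  have h' : (x : ℝ) ≤ y := h
  have h1 : (f (Set.projIcc 0 1 zero_le_one (2 * (x : ℝ))) : ℝ) ≤
      f (Set.projIcc 0 1 zero_le_one (2 * (y : ℝ))) :=
    f.monotone (Set.monotone_projIcc _ (by linarith))
  have h2 : (g (Set.projIcc 0 1 zero_le_one (2 * (x : ℝ) - 1)) : ℝ) ≤
      g (Set.projIcc 0 1 zero_le_one (2 * (y : ℝ) - 1)) :=
    g.monotone (Set.monotone_projIcc _ (by linarith))
  change (_ : ℝ) ≤ _
  simp only [juxtaposeFun]
  linarith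

/-- The homeomorphism that acts as `f` on the left and as `g` on the right half of the unit
interval. -/
noncomputable def juxtapose (f g : unitInterval ≃o unitInterval) : unitInterval ≃o unitInterval :=
  Equiv.toOrderIso
    { toFun := juxtaposeFun f g
      invFun := juxtaposeFun f⁻¹ g⁻¹
      left_inv := fun x => by
        rw [juxtaposeFun_comp, inv_mul_cancel, inv_mul_cancel, juxtaposeFun_one]
      right_inv := fun x => by
        rw [juxtaposeFun_comp, mul_inv_cancel, mul_inv_cancel, juxtaposeFun_one] }
    (juxtaposeFun_mono f g) (juxtaposeFun_mono f⁻¹ g⁻¹)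

theorem juxtapose_mul (f g f' g' : unitInterval ≃o unitInterval) :
    juxtapose f g * juxtapose f' g' = juxtapose (f * f') (g * g') :=
  RelIso.ext fun x => juxtaposeFun_comp f g f' g' x

theorem juxtapose_one : juxtapose 1 1 = 1 := RelIso.ext juxtaposeFun_one

theorem juxtapose_of_le (f g : unitInterval ≃o unitInterval) {x : unitInterval}
    (h : (x : ℝ) ≤ 1 / 2) :
    (juxtapose f g x : ℝ) = f (Set.projIcc 0 1 zero_le_one (2 * (x : ℝ))) / 2 :=
  juxtaposeFun_of_le f g h

theorem juxtapose_of_ge (f g : unitInterval ≃o unitInterval) {x : unitInterval}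
    (h : 1 / 2 ≤ (x : ℝ)) :
    (juxtapose f g x : ℝ) = (1 + g (Set.projIcc 0 1 zero_le_one (2 * (x : ℝ) - 1))) / 2 :=
  juxtaposeFun_of_ge f g h

theorem juxtapose_injective {f g f' g' : unitInterval ≃o unitInterval}
    (h : juxtapose f g = juxtapose f' g') : f = f' ∧ g = g' := by
  constructor
  · ext x
    have h0 := x.2.1
    have h1 := x.2.2
    have := congrArg (fun k : unitInterval ≃o unitInterval =>
      ((k ⟨x / 2, by constructor <;> linarith⟩ : unitInterval) : ℝ)) h
    rw [juxtapose_of_le _ _ (by dsimp only; linarith),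
      juxtapose_of_le _ _ (by dsimp only; linarith), mul_div_cancel₀ _ two_ne_zero,
      Set.projIcc_val] at this
    linarith
  · ext x
    have h0 := x.2.1
    have h1 := x.2.2
    have := congrArg (fun k : unitInterval ≃o unitInterval =>
      ((k ⟨(x + 1) / 2, by constructor <;> linarith⟩ : unitInterval) : ℝ)) h
    rw [juxtapose_of_ge _ _ (by dsimp only; linarith),
      juxtapose_of_ge _ _ (by dsimp only; linarith), mul_div_cancel₀ _ two_ne_zero,
      add_sub_cancel_right, Set.projIcc_val] at this
    linarith

end Juxtapose

/-! ### Piecewise linear maps given by pairs of trees -/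

theorem plMap_append (L L' : List (ℕ × ℕ)) {x : ℝ} (hx : 0 ≤ x) :
    plMap (L ++ L') x =
      if x ≤ (L.map fun a => (2 : ℝ) ^ (-a.1 : ℤ)).sum then plMap L x
      else (L.map fun a => (2 : ℝ) ^ (-a.2 : ℤ)).sum +
        plMap L' (x - (L.map fun a => (2 : ℝ) ^ (-a.1 : ℤ)).sum) := by
  induction L generalizing x with
  | nil =>
    simp only [List.nil_append, List.map_nil, List.sum_nil, sub_zero, zero_add]
    split_ifs with h
    · rw [le_antisymm h hx, plMap_zero, plMap_zero]
    · rfl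
  | cons a L ih =>
    obtain ⟨d, e⟩ := a
    have h0 : 0 ≤ (L.map fun a => (2 : ℝ) ^ (-a.1 : ℤ)).sum :=
      List.sum_nonneg (by simp only [List.mem_map]; rintro _ ⟨a, _, rfl⟩; positivity)
    simp only [List.cons_append, plMap, List.map_cons, List.sum_cons]
    by_cases h : x ≤ 2 ^ (-d : ℤ)
    · rw [if_pos h, if_pos h, if_pos (by linarith)]
    · rw [if_neg h, if_neg h, ih (by linarith)]
      by_cases h' : x - 2 ^ (-d : ℤ) ≤ (L.map fun a => (2 : ℝ) ^ (-a.1 : ℤ)).sum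
      · rw [if_pos h', if_pos (by linarith)]
      · rw [if_neg h', if_neg (by intro h''; apply h'; linarith), sub_sub]
        ring

theorem plMap_cons_congr {L L' : List (ℕ × ℕ)} (d e : ℕ)
    (h : ∀ x, 0 ≤ x → plMap L x = plMap L' x) (x : ℝ) :
    plMap ((d, e) :: L) x = plMap ((d, e) :: L') x := by
  simp only [plMap]
  split_ifs with hx
  · rfl
  · rw [h _ (by linarith)]

theorem plMap_map_succ (L : List (ℕ × ℕ)) (x : ℝ) :
    plMap (L.map (Prod.map (· + 1) (· + 1))) x = plMap L (2 * x) / 2 := by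
  have h : ∀ d : ℕ, (2 : ℝ) ^ (-((d + 1 : ℕ) : ℤ)) = 2 ^ (-d : ℤ) / 2 := by
    intro d
    push_cast
    rw [neg_add, zpow_add₀ (by norm_num)]
    norm_num
    ring
  induction L generalizing x with
  | nil => simp [plMap]
  | cons a L ih =>
    obtain ⟨d, e⟩ := a
    simp only [List.map_cons, Prod.map_apply, plMap, ih, h]
    by_cases h' : 2 * x ≤ 2 ^ (-d : ℤ)
    · rw [if_pos h', if_pos (by linarith)]
      push_cast
      rw [add_sub_add_right_eq_sub]
      ring
    · rw [if_neg h', if_neg (by intro h''; apply h'; linarith)]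
      ring_nf

theorem plMap_zip_comp {C D E : List ℕ} (h : C.length = D.length) (h' : D.length = E.length)
    (x : ℝ) : plMap (D.zip E) (plMap (C.zip D) x) = plMap (C.zip E) x := by
  induction C generalizing D E x with
  | nil =>
    obtain rfl : D = [] := by simpa using h.symm
    obtain rfl : E = [] := by simpa using h'.symm
    rfl
  | cons c C ih =>
    obtain ⟨d, D, rfl⟩ := List.exists_cons_of_length_pos (l := D) (by simp [← h])
    obtain ⟨e, E, rfl⟩ := List.exists_cons_of_length_pos (l := E) (by simp [← h'])
    simp only [List.length_cons, Nat.add_right_cancel_iff] at h h'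
    have h2 : (0 : ℝ) < 2 ^ ((c : ℤ) - d) := by positivity
    have h3 := two_zpow_mul_neg c d
    simp only [List.zip_cons_cons, plMap]
    by_cases hx : x ≤ 2 ^ (-c : ℤ)
    · have := mul_le_mul_of_nonneg_left hx h2.le
      rw [if_pos hx, if_pos hx, if_pos (by linarith), ← mul_assoc, ← zpow_add₀ (by norm_num)]
      congr 2
      ring
    · have h4 : plMap (C.zip D) 0 < plMap (C.zip D) (x - 2 ^ (-c : ℤ)) :=
        plMap_strictMono _ (by linarith)
      rw [plMap_zero] at h4
      rw [if_neg hx, if_neg hx, if_neg (by linarith), add_sub_cancel_left, ih h h']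

theorem plMap_zip_self (D : List ℕ) (x : ℝ) : plMap (D.zip D) x = x := by
  induction D generalizing x with
  | nil => rfl
  | cons d D ih => simp [plMap, ih]

theorem plMap_map_add (D : List ℕ) (p q : ℕ) {x : ℝ}
    (hx : x ≤ ((D.map fun d : ℕ => (2 : ℝ) ^ (-d : ℤ)).sum) * 2 ^ (-p : ℤ)) (h0 : 0 ≤ x) :
    plMap (D.map fun d => (d + p, d + q)) x = 2 ^ ((p : ℤ) - q) * x := by
  have h : ∀ d p : ℕ, (2 : ℝ) ^ (-((d + p : ℕ) : ℤ)) = 2 ^ (-d : ℤ) * 2 ^ (-p : ℤ) := by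
    intro d p
    push_cast
    rw [neg_add, zpow_add₀ (by norm_num)]
  induction D generalizing x with
  | nil =>
    simp only [List.map_nil, List.sum_nil, zero_mul] at hx
    rw [le_antisymm hx h0]
    simp [plMap]
  | cons d D ih =>
    simp only [List.map_cons, List.sum_cons, plMap, h] at hx ⊢
    split_ifs with h'
    · push_cast
      rw [add_sub_add_left_eq_sub]
    · rw [ih (by linarith) (by linarith), ← two_zpow_mul_neg p q]
      ring

theorem sum_leafDepths_map_add (T : BinaryTree Unit) (p : ℕ) :
    (((leafDepths T).map (· + p)).map fun d : ℕ => (2 : ℝ) ^ (-d : ℤ)).sum = 2 ^ (-p : ℤ) := by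
  have h : ∀ d : ℕ, (2 : ℝ) ^ (-((d + p : ℕ) : ℤ)) = 2 ^ (-d : ℤ) * 2 ^ (-p : ℤ) := by
    intro d
    push_cast
    rw [neg_add, zpow_add₀ (by norm_num)]
  rw [List.map_map]
  simp only [Function.comp_def, h]
  rw [List.sum_map_mul_right, sum_leafDepths, one_mul]

/-- Hanging the same tree T below corresponding leaves of depths p and q only subdivides a piece on
which the map is already affine. -/
theorem plMap_leafDepths_append (T : BinaryTree Unit) (p q : ℕ) (L : List (ℕ × ℕ)) {x : ℝ}
    (hx : 0 ≤ x) :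
    plMap (((leafDepths T).map fun d => (d + p, d + q)) ++ L) x = plMap ((p, q) :: L) x := by
  have h1 := sum_leafDepths_map_add T p
  have h2 := sum_leafDepths_map_add T q
  rw [List.map_map] at h1 h2
  simp only [Function.comp_def] at h1 h2
  rw [plMap_append _ _ hx, List.map_map, List.map_map]
  simp only [Function.comp_def]
  rw [h1, h2, plMap]
  split_ifs with h
  · rw [plMap_map_add _ _ _ (by rwa [sum_leafDepths, one_mul]) hx]
  · rfl

/-- The homeomorphism `f` of the unit interval maps the intervals of the leaves of `S` affinely to
those of the leaves of `T`. -/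
def Represents (S T : BinaryTree Unit) (f : unitInterval ≃o unitInterval) : Prop :=
  S.numNodes = T.numNodes ∧
    ∀ x : unitInterval, (f x : ℝ) = plMap ((leafDepths S).zip (leafDepths T)) x

theorem Represents.length_eq {S T : BinaryTree Unit} {f : unitInterval ≃o unitInterval}
    (h : Represents S T f) : (leafDepths S).length = (leafDepths T).length := by
  rw [length_leafDepths, length_leafDepths, h.1]

theorem Represents.unique {S T : BinaryTree Unit} {f g : unitInterval ≃o unitInterval}
    (hf : Represents S T f) (hg : Represents S T g) : f = g :=
  RelIso.ext fun x => Subtype.ext ((hf.2 x).trans (hg.2 x).symm)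

theorem Represents.refl (S : BinaryTree Unit) : Represents S S 1 :=
  ⟨rfl, fun x => by rw [plMap_zip_self]; rfl⟩

theorem Represents.mul {R S T : BinaryTree Unit} {f g : unitInterval ≃o unitInterval}
    (hf : Represents S T f) (hg : Represents R S g) : Represents R T (f * g) :=
  ⟨hg.1.trans hf.1, fun x => by
    rw [← plMap_zip_comp hg.length_eq hf.length_eq, ← hg.2 x, ← hf.2]; rfl⟩

theorem Represents.inv {S T : BinaryTree Unit} {f : unitInterval ≃o unitInterval}
    (hf : Represents S T f) : Represents T S f⁻¹ :=
  ⟨hf.1.symm, fun x => by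
    have h := hf.2 (f⁻¹ x)
    rw [← RelIso.mul_apply, mul_inv_cancel, RelIso.one_apply] at h
    rw [h, plMap_zip_comp hf.length_eq hf.length_eq.symm, plMap_zip_self]⟩

theorem Represents.juxtapose {l r l' r' : BinaryTree Unit} {f g : unitInterval ≃o unitInterval}
    (hf : Represents l l' f) (hg : Represents r r' g) :
    Represents (.node () l r) (.node () l' r') (juxtapose f g) := by
  refine ⟨by simp [hf.1, hg.1], fun x => ?_⟩
  have hx0 := x.2.1
  have hx1 := x.2.2
  have h1 : ((leafDepths l).zip (leafDepths l')).map Prod.fst = leafDepths l :=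
    List.map_fst_zip hf.length_eq.le
  have h2 : ((leafDepths l).zip (leafDepths l')).map Prod.snd = leafDepths l' :=
    List.map_snd_zip hf.length_eq.ge
  have e1 := sum_leafDepths l
  have e2 := sum_leafDepths l'
  rw [← h1, List.map_map] at e1
  rw [← h2, List.map_map] at e2
  simp only [Function.comp_def] at e1 e2
  rw [leafDepths, leafDepths, List.zip_map, List.zip_append hf.length_eq,
    plMap_map_succ, plMap_append _ _ (by linarith), e1, e2]
  split_ifs with h
  · rw [juxtapose_of_le _ _ (by linarith), hf.2,
      Set.projIcc_of_mem zero_le_one ⟨by linarith, by linarith⟩]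
  · rw [juxtapose_of_ge _ _ (by linarith), hg.2,
      Set.projIcc_of_mem zero_le_one ⟨by linarith, by linarith⟩]

/-! ### The standard generators and the group that they generate -/

/-- The tree pair of the standard generator `x₀` of Thompson's group. -/
def rotationPair : ReducedTreePair where
  source := .node () (.node () .nil .nil) .nil
  target := .node () .nil (.node () .nil .nil)
  numNodes_eq := rfl
  numNodes_pos := by decide
  reduced := Or.inr (by decide)

/-- The standard generator `x₀` of Thompson's group. -/
noncomputable def rotationIso : unitInterval ≃o unitInterval := rotationPair.toOrderIso

theorem represents_toOrderIso (p : ReducedTreePair) :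
    Represents p.source p.target p.toOrderIso := ⟨p.numNodes_eq, fun _ => rfl⟩

/-- The trees A, B, C subdivide the three affine pieces of x₀. Identities between products of
generators can therefore be checked by following trees through rotations. -/
theorem represents_rotation (A B C : BinaryTree Unit) :
    Represents (.node () (.node () A B) C) (.node () A (.node () B C)) rotationIso := by
  refine ⟨by simp only [BinaryTree.numNodes]; ring, fun x => ?_⟩
  have hx := x.2.1
  have h : (leafDepths (.node () (.node () A B) C)).zip (leafDepths (.node () A (.node () B C))) =
      ((leafDepths A).map fun d => (d + 2, d + 1)) ++ (((leafDepths B).map fun d => (d + 2, d + 2)) ++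
        (((leafDepths C).map fun d => (d + 1, d + 2)) ++ [])) := by
    simp only [leafDepths, List.map_append, List.map_map, List.append_assoc]
    rw [List.zip_append (by simp), List.zip_append (by simp)]
    simp [List.zip_map', Function.comp_def]
  have h' : (leafDepths rotationPair.source).zip (leafDepths rotationPair.target) =
      [(2, 1), (2, 2), (1, 2)] := by decide
  rw [h, plMap_leafDepths_append _ _ _ _ hx, rotationIso, (represents_toOrderIso rotationPair).2,
    h']
  refine plMap_cons_congr _ _ (fun y hy => ?_) _
  rw [plMap_leafDepths_append _ _ _ _ hy]
  refine plMap_cons_congr _ _ (fun z hz => ?_) _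
  rw [plMap_leafDepths_append _ _ _ _ hz]

/-- The second standard generator `x₁` of Thompson's group. -/
noncomputable def rotationIso' : unitInterval ≃o unitInterval := juxtapose 1 rotationIso

/-- The group generated by the standard generators of Thompson's group. -/
noncomputable def standardSubgroup : Subgroup (unitInterval ≃o unitInterval) :=
  Subgroup.closure {rotationIso, rotationIso'}

theorem rotationIso_mem : rotationIso ∈ standardSubgroup :=
  Subgroup.subset_closure (Or.inl rfl)

theorem rotationIso'_mem : rotationIso' ∈ standardSubgroup :=
  Subgroup.subset_closure (Or.inr rfl)

theorem represents_rotationIso' (A B C D : BinaryTree Unit) :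
    Represents (.node () A (.node () (.node () B C) D)) (.node () A (.node () B (.node () C D)))
      rotationIso' :=
  (Represents.refl A).juxtapose (represents_rotation B C D)

/-- Juxtaposition, as a homomorphism of groups. -/
noncomputable def juxtaposeHom :
    (unitInterval ≃o unitInterval) × (unitInterval ≃o unitInterval) →*
      (unitInterval ≃o unitInterval) where
  toFun p := juxtapose p.1 p.2
  map_one' := juxtapose_one
  map_mul' p q := (juxtapose_mul p.1 p.2 q.1 q.2).symm

theorem juxtapose_one_right_mem {f : unitInterval ≃o unitInterval} (hf : f ∈ standardSubgroup) :
    juxtapose 1 f ∈ standardSubgroup := by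
  let φ := juxtaposeHom.comp (MonoidHom.inr (unitInterval ≃o unitInterval) _)
  suffices h : standardSubgroup ≤ standardSubgroup.comap φ from h hf
  rw [standardSubgroup, Subgroup.closure_le, ← standardSubgroup]
  rintro g (rfl | rfl)
  · exact rotationIso'_mem
  · change juxtapose 1 rotationIso' ∈ standardSubgroup
    -- This is x₂: conjugation by x₀ moves the support of x₁ from the right half to the last
    -- quarter.
    have h : juxtapose 1 rotationIso' = rotationIso * rotationIso' * rotationIso⁻¹ :=
      ((Represents.refl .nil).juxtapose (represents_rotationIso' .nil .nil .nil .nil)).unique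
        (((represents_rotation _ _ _).mul
          (represents_rotationIso' (.node () .nil .nil) .nil .nil .nil)).mul
            (represents_rotation _ _ _).inv)
    rw [h]
    exact mul_mem (mul_mem rotationIso_mem rotationIso'_mem) (inv_mem rotationIso_mem)

/-- This is Mac Lane's pentagon: the rotation ((AB)C)D → (A(BC))D equals the way round through
(AB)(CD), A(B(CD)) and A((BC)D). -/
theorem juxtapose_rotationIso_one_mem : juxtapose rotationIso 1 ∈ standardSubgroup := by
  have h : juxtapose rotationIso 1 = rotationIso⁻¹ * rotationIso'⁻¹ * rotationIso * rotationIso :=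
    ((represents_rotation .nil .nil .nil).juxtapose (Represents.refl .nil)).unique
      ((((represents_rotation _ _ _).inv.mul (represents_rotationIso' _ _ _ _).inv).mul
        (represents_rotation _ _ _)).mul (represents_rotation _ _ _))
  rw [h]
  exact mul_mem (mul_mem (mul_mem (inv_mem rotationIso_mem) (inv_mem rotationIso'_mem))
    rotationIso_mem) rotationIso_mem

theorem juxtapose_one_left_mem {f : unitInterval ≃o unitInterval} (hf : f ∈ standardSubgroup) :
    juxtapose f 1 ∈ standardSubgroup := by
  let φ := juxtaposeHom.comp (MonoidHom.inl _ (unitInterval ≃o unitInterval))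
  suffices h : standardSubgroup ≤ standardSubgroup.comap φ from h hf
  rw [standardSubgroup, Subgroup.closure_le, ← standardSubgroup]
  rintro g (rfl | rfl)
  · exact juxtapose_rotationIso_one_mem
  · change juxtapose rotationIso' 1 ∈ standardSubgroup
    -- Conjugation by x₀ takes the second quarter to the third, where the element lies in the right
    -- half and is already known to be generated.
    have h : juxtapose rotationIso' 1 =
        rotationIso⁻¹ * juxtapose 1 (juxtapose rotationIso 1) * rotationIso :=
      ((represents_rotationIso' .nil .nil .nil .nil).juxtapose (Represents.refl .nil)).unique
        (((represents_rotation _ _ _).inv.mul ((Represents.refl _).juxtapose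
          ((represents_rotation _ _ _).juxtapose (Represents.refl _)))).mul
            (represents_rotation _ _ _))
    rw [h]
    exact mul_mem (mul_mem (inv_mem rotationIso_mem)
      (juxtapose_one_right_mem juxtapose_rotationIso_one_mem)) rotationIso_mem

theorem juxtapose_mem {f g : unitInterval ≃o unitInterval} (hf : f ∈ standardSubgroup)
    (hg : g ∈ standardSubgroup) : juxtapose f g ∈ standardSubgroup := by
  have := mul_mem (juxtapose_one_left_mem hf) (juxtapose_one_right_mem hg)
  rwa [juxtapose_mul, mul_one, one_mul] at this

/-- The tree with `n` carets each of which is the right child of the one before. -/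
def rightComb : ℕ → BinaryTree Unit
  | 0 => .nil
  | n + 1 => .node () .nil (rightComb n)

/-- One rotation at the root moves a caret from the left comb to the right, and the rest happens
inside the right subtree. -/
theorem exists_represents_node_rightComb (a b : ℕ) : ∃ f ∈ standardSubgroup,
    Represents (.node () (rightComb a) (rightComb b)) (rightComb (a + b + 1)) f := by
  induction a with
  | zero =>
    refine ⟨1, one_mem _, ?_⟩
    rw [zero_add]
    exact Represents.refl _
  | succ a ih =>
    obtain ⟨f, hf, h⟩ := ih
    refine ⟨juxtapose 1 f * rotationIso, mul_mem (juxtapose_one_right_mem hf) rotationIso_mem, ?_⟩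
    rw [show a + 1 + b + 1 = (a + b + 1) + 1 by ring]
    exact ((Represents.refl .nil).juxtapose h).mul (represents_rotation _ _ _)

theorem exists_represents_rightComb (S : BinaryTree Unit) : ∃ f ∈ standardSubgroup,
    Represents S (rightComb S.numNodes) f := by
  induction S with
  | nil => exact ⟨1, one_mem _, Represents.refl _⟩
  | node _ l r hl hr =>
    obtain ⟨f, hf, hf'⟩ := hl
    obtain ⟨g, hg, hg'⟩ := hr
    obtain ⟨h, hh, hh'⟩ := exists_represents_node_rightComb l.numNodes r.numNodes
    exact ⟨h * juxtapose f g, mul_mem hh (juxtapose_mem hf hg), hh'.mul (hf'.juxtapose hg')⟩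

/-- Both trees are brought to the same right comb by elements of the generated group. -/
theorem Represents.mem_standardSubgroup {S T : BinaryTree Unit} {f : unitInterval ≃o unitInterval}
    (h : Represents S T f) : f ∈ standardSubgroup := by
  obtain ⟨g, hg, hg'⟩ := exists_represents_rightComb S
  obtain ⟨k, hk, hk'⟩ := exists_represents_rightComb T
  rw [← h.1] at hk'
  rw [h.unique (hk'.inv.mul hg')]
  exact mul_mem (inv_mem hk) hg

/-! ### Elements of Thompson's group are represented by pairs of trees -/

theorem affine_unique {m n : ℤ} {q r y : ℝ}
    (h : ∀ᶠ z in 𝓝 y, (2 : ℝ) ^ m * z + q = 2 ^ n * z + r) : m = n ∧ q = r := by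
  have h0 := h.self_of_nhds
  obtain ⟨z, hz, hzy⟩ := ((h.filter_mono nhdsWithin_le_nhds).and
    (self_mem_nhdsWithin (s := {y}ᶜ))).exists
  have hzy' : z - y ≠ 0 := sub_ne_zero.2 hzy
  have h1 : ((2 : ℝ) ^ m - 2 ^ n) * (z - y) = 0 := by linear_combination hz - h0
  have h2 : (2 : ℝ) ^ m = 2 ^ n := by
    rcases mul_eq_zero.1 h1 with h | h
    · exact sub_eq_zero.1 h
    · exact absurd h hzy'
  refine ⟨zpow_right_injective₀ (by norm_num) (by norm_num) h2, ?_⟩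
  rw [h2] at h0
  linarith

/-- An affine germ determines its coefficients, so these are locally constant on a connected
interval, hence constant. The endpoints follow by continuity. -/
theorem exists_affine_of_locally_affine {F : ℝ → ℝ} (hF : Continuous F) {a b : ℝ} (hab : a < b)
    (h : ∀ x ∈ Set.Ioo a b, ∃ (m : ℤ) (q : ℝ), IsDyadic q ∧ ∀ᶠ y in 𝓝 x, F y = 2 ^ m * y + q) :
    ∃ (m : ℤ) (q : ℝ), IsDyadic q ∧ ∀ x ∈ Set.Icc a b, F x = 2 ^ m * x + q := by
  choose m q hq hm using fun x : Set.Ioo a b => h x x.2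
  have : PreconnectedSpace (Set.Ioo a b) := Subtype.preconnectedSpace isPreconnected_Ioo
  have hc : IsLocallyConstant fun x => (m x, q x) := by
    rw [IsLocallyConstant.iff_eventually_eq]
    intro x
    filter_upwards [continuous_subtype_val.continuousAt.eventually
      (eventually_eventually_nhds.2 (hm x))] with y hy
    have := affine_unique (m := m y) (n := m x) (q := q y) (r := q x) (y := y) (by
      filter_upwards [hy, hm y] with z h1 h2
      rw [← h1, ← h2])
    exact Prod.ext this.1 this.2
  obtain ⟨c, hc'⟩ := Set.nonempty_Ioo.2 hab
  refine ⟨m ⟨c, hc'⟩, q ⟨c, hc'⟩, hq _, fun x hx => ?_⟩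
  rw [← closure_Ioo hab.ne] at hx
  refine Set.EqOn.closure (s := Set.Ioo a b) (fun z hz => ?_) hF
    ((continuous_const.mul continuous_id).add continuous_const) hx
  have h1 := hc.apply_eq_of_preconnectedSpace ⟨z, hz⟩ ⟨c, hc'⟩
  rw [Prod.mk.injEq] at h1
  rw [(hm ⟨z, hz⟩).self_of_nhds, h1.1, h1.2]
  rfl

/-- A homeomorphism of the unit interval, extended to the real line by constants. -/
noncomputable def extendIso (f : unitInterval ≃o unitInterval) (x : ℝ) : ℝ :=
  f (Set.projIcc 0 1 zero_le_one x)

theorem continuous_extendIso (f : unitInterval ≃o unitInterval) : Continuous (extendIso f) :=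
  continuous_subtype_val.comp (f.continuous.comp continuous_projIcc)

theorem extendIso_coe (f : unitInterval ≃o unitInterval) (x : unitInterval) :
    extendIso f x = f x := by
  rw [extendIso, Set.projIcc_val]

theorem extendIso_zero (f : unitInterval ≃o unitInterval) : extendIso f 0 = 0 := by
  rw [extendIso, projIcc_of_le_zero le_rfl, f.unitInterval_map_zero]
  rfl

theorem extendIso_one (f : unitInterval ≃o unitInterval) : extendIso f 1 = 1 := by
  rw [extendIso, projIcc_of_one_le le_rfl, f.unitInterval_map_one]
  rfl

theorem exists_affine_on_dyadic_intervals {f : unitInterval ≃o unitInterval} (hf : f ∈ ThompsonF) :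
    ∃ N : ℕ, ∀ i : ℕ, i < 2 ^ N → ∃ (m : ℤ) (q : ℝ), IsDyadic q ∧
      ∀ x ∈ Set.Icc ((i : ℝ) / 2 ^ N) ((i + 1) / 2 ^ N), extendIso f x = 2 ^ m * x + q := by
  obtain ⟨B, hBf, hBd, hB⟩ := hf
  have h1 : ∃ N : ℕ, ∀ b ∈ B, ∃ a : ℤ, (b : ℝ) = a / 2 ^ N := by
    choose! a n h using fun b hb => (hBd b hb).1
    obtain ⟨N, hN⟩ := (hBf.image n).bddAbove
    refine ⟨N, fun b hb => ⟨a b * 2 ^ (N - n b), ?_⟩⟩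
    have h2 : n b ≤ N := hN ⟨b, hb, rfl⟩
    have h3 : (2 : ℝ) ^ N = 2 ^ (N - n b) * 2 ^ n b := by rw [← pow_add, Nat.sub_add_cancel h2]
    rw [h b hb, h3]
    push_cast
    field_simp
  obtain ⟨N, hN⟩ := h1
  refine ⟨N, fun i hi => ?_⟩
  have h2 : (0 : ℝ) < 2 ^ N := by positivity
  have hi' : ((i : ℝ) + 1) ≤ 2 ^ N := by exact_mod_cast hi
  refine exists_affine_of_locally_affine (continuous_extendIso f)
    (div_lt_div_of_pos_right (by linarith) h2) fun x hx => ?_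
  have hx0 : 0 < x := lt_of_le_of_lt (by positivity) hx.1
  have hx1 : x < 1 := lt_of_lt_of_le hx.2 (div_le_one_of_le₀ hi' h2.le)
  obtain ⟨m, q, hq, hm⟩ := hB ⟨x, hx0.le, hx1.le⟩ (by
    intro hxB
    obtain ⟨a, ha⟩ := hN _ hxB
    simp only at ha
    rw [ha, Set.mem_Ioo, div_lt_div_iff_of_pos_right h2, div_lt_div_iff_of_pos_right h2] at hx
    have h3 : (i : ℤ) < a := by exact_mod_cast hx.1
    have h4 : a < (i : ℤ) + 1 := by exact_mod_cast hx.2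
    lia)
  refine ⟨m, q, hq, ?_⟩
  have hp : Tendsto (Set.projIcc (0 : ℝ) 1 zero_le_one) (𝓝 x) (𝓝 ⟨x, hx0.le, hx1.le⟩) := by
    rw [← Set.projIcc_of_mem zero_le_one ⟨hx0.le, hx1.le⟩]
    exact continuous_projIcc.continuousAt
  filter_upwards [hp.eventually hm, eventually_gt_nhds hx0, eventually_lt_nhds hx1] with y h5 h6 h7
  rw [Set.projIcc_of_mem zero_le_one ⟨h6.le, h7.le⟩] at h5
  rw [extendIso, Set.projIcc_of_mem zero_le_one ⟨h6.le, h7.le⟩, h5]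

/-- On a piece x ↦ 2^m x + c/2^e, an interval [j, j+1]/2^(N+K) has an image of length 2^(-D) with D
= N + K - m, starting at j/2^D + c/2^e. For K ≥ m + e this start is a multiple of 2^(-D), so the
image is a standard dyadic interval. -/
theorem exists_standard_dyadic_intervals {f : unitInterval ≃o unitInterval} (hf : f ∈ ThompsonF) :
    ∃ n : ℕ, ∀ j : ℕ, j < 2 ^ n → ∃ (D : ℕ) (z : ℤ), extendIso f ((j : ℝ) / 2 ^ n) = z / 2 ^ D ∧
      ∀ x ∈ Set.Icc ((j : ℝ) / 2 ^ n) ((j + 1) / 2 ^ n),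
        extendIso f x = extendIso f ((j : ℝ) / 2 ^ n) + 2 ^ ((n : ℤ) - D) * (x - j / 2 ^ n) := by
  obtain ⟨N, hN⟩ := exists_affine_on_dyadic_intervals hf
  choose! m q hq hm using hN
  choose! c e he using hq
  obtain ⟨K, hK⟩ := ((Set.finite_lt_nat (2 ^ N)).image fun i => (m i).toNat + e i).bddAbove
  have hK' : ∀ i : ℕ, i < 2 ^ N → m i + e i ≤ K := by
    intro i hi
    have : (m i).toNat + e i ≤ K := hK ⟨i, hi, rfl⟩
    lia
  refine ⟨N + K, fun j hj => ?_⟩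
  have hi : j / 2 ^ K < 2 ^ N := by
    rw [Nat.div_lt_iff_lt_mul (by positivity), ← pow_add]
    exact hj
  set i := j / 2 ^ K with hidef
  have h1 : i * 2 ^ K ≤ j := Nat.div_mul_le_self _ _
  have h2 : j + 1 ≤ (i + 1) * 2 ^ K := by
    have := Nat.lt_div_mul_add (a := j) (b := 2 ^ K) (by positivity)
    rw [← hidef] at this
    lia
  have h1' : (i : ℝ) * 2 ^ K ≤ j := by exact_mod_cast h1
  have h2' : (j : ℝ) + 1 ≤ (i + 1) * 2 ^ K := by exact_mod_cast h2
  have hsub : Set.Icc ((j : ℝ) / 2 ^ (N + K)) ((j + 1) / 2 ^ (N + K)) ⊆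
      Set.Icc ((i : ℝ) / 2 ^ N) ((i + 1) / 2 ^ N) := by
    refine Set.Icc_subset_Icc ?_ ?_
    · rw [pow_add, div_le_div_iff₀ (by positivity) (by positivity)]
      nlinarith [show (0 : ℝ) < 2 ^ N by positivity]
    · rw [pow_add, div_le_div_iff₀ (by positivity) (by positivity)]
      nlinarith [show (0 : ℝ) < 2 ^ N by positivity]
  have hj' : (j : ℝ) / 2 ^ (N + K) ∈ Set.Icc ((j : ℝ) / 2 ^ (N + K)) ((j + 1) / 2 ^ (N + K)) :=
    ⟨le_rfl, by gcongr; linarith⟩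
  have hle := hK' i hi
  obtain ⟨D, hD⟩ := Int.eq_ofNat_of_zero_le (a := (N : ℤ) + K - m i) (by lia)
  obtain ⟨r, hr⟩ := Int.eq_ofNat_of_zero_le (a := (D : ℤ) - e i) (by lia)
  refine ⟨D, j + c i * 2 ^ r, ?_, fun x hx => ?_⟩
  · have e1 : (2 : ℝ) ^ m i = 2 ^ (N + K) / 2 ^ D := by
      rw [eq_div_iff (by positivity), ← zpow_natCast, ← zpow_add₀ (by norm_num), ← zpow_natCast]
      congr 1
      push_cast
      lia
    have e2 : (2 : ℝ) ^ D = 2 ^ r * 2 ^ e i := by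
      rw [← pow_add]
      congr 1
      lia
    rw [hm i hi _ (hsub hj'), he i hi, e1]
    push_cast
    have e3 : (c i : ℝ) / 2 ^ e i = c i * 2 ^ r / 2 ^ D := by
      rw [e2]
      field_simp
    rw [e3]
    field_simp
  · rw [hm i hi _ (hsub hx), hm i hi _ (hsub hj')]
    have : ((N + K : ℕ) : ℤ) - D = m i := by
      push_cast
      lia
    rw [this]
    ring

/-- The consecutive intervals of lengths `2 ^ (-d₁), 2 ^ (-d₂), …`, starting at `p`, are standard
dyadic intervals. -/
def Aligned : ℝ → List ℕ → Prop
  | _, [] => True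
  | p, d :: L => (∃ z : ℤ, p = z / 2 ^ d) ∧ Aligned (p + 2 ^ (-d : ℤ)) L

theorem Aligned.of_append {p : ℝ} {L L' : List ℕ} (h : Aligned p (L ++ L')) :
    Aligned (p + (L.map fun d : ℕ => (2 : ℝ) ^ (-d : ℤ)).sum) L' := by
  induction L generalizing p with
  | nil => simpa using h
  | cons d L ih =>
    have := ih h.2
    rwa [List.map_cons, List.sum_cons, ← add_assoc]

/-- A tree filling the standard interval of depth d at p is split off the list. Either the first
interval is all of it, a leaf, or the two halves are filled recursively. The induction is on k,
where d + k bounds the depths in the list. -/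
theorem Aligned.exists_leafDepths (k : ℕ) : ∀ (d : ℕ) (p : ℝ) (L : List ℕ), Aligned p L →
    (∀ e ∈ L, e ≤ d + k) → (∃ z : ℤ, p = z / 2 ^ d) →
    2 ^ (-d : ℤ) ≤ (L.map fun d : ℕ => (2 : ℝ) ^ (-d : ℤ)).sum → (∀ e ∈ L.head?, d ≤ e) →
    ∃ (T : BinaryTree Unit) (R : List ℕ), L = (leafDepths T).map (· + d) ++ R := by
  have hpos : ∀ d : ℕ, (0 : ℝ) < 2 ^ (-d : ℤ) := fun d => by positivity
  have hsucc : ∀ d : ℕ, (2 : ℝ) ^ (-d : ℤ) = 2 ^ (-(d + 1 : ℕ) : ℤ) + 2 ^ (-(d + 1 : ℕ) : ℤ) := by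
    intro d
    push_cast
    rw [neg_add, zpow_add₀ (by norm_num)]
    norm_num
    ring
  induction k with
  | zero =>
    intro d p L _ hle _ hsum hhead
    match L with
    | [] =>
      simp only [List.map_nil, List.sum_nil] at hsum
      linarith [hpos d]
    | e :: L =>
      have h1 := hle e (by simp)
      have h2 := hhead e (by simp)
      obtain rfl : e = d := by lia
      exact ⟨.nil, L, by simp [leafDepths]⟩
  | succ k ih =>
    intro d p L hL hle hp hsum hhead
    match L with
    | [] =>
      simp only [List.map_nil, List.sum_nil] at hsum
      linarith [hpos d]
    | e :: L =>
      rcases (hhead e (by simp)).eq_or_lt with rfl | hlt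
      · exact ⟨.nil, L, by simp [leafDepths]⟩
      · obtain ⟨z, hz⟩ := hp
        have hle' : ∀ e' ∈ e :: L, e' ≤ d + 1 + k := fun e' he' => by
          have := hle e' he'
          lia
        obtain ⟨T, R, hT⟩ := ih (d + 1) p (e :: L) hL hle'
          ⟨2 * z, by rw [hz]; push_cast; rw [pow_succ']; field_simp⟩
          (by linarith [hpos (d + 1), hsucc d]) (by simpa using hlt)
        rw [hT] at hL hsum hle'
        have hR := hL.of_append
        rw [sum_leafDepths_map_add] at hR
        rw [List.map_append, List.sum_append, sum_leafDepths_map_add] at hsum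
        have hp' : p + 2 ^ (-(d + 1 : ℕ) : ℤ) = ((2 * z + 1 : ℤ) : ℝ) / 2 ^ (d + 1) := by
          rw [hz, zpow_neg, zpow_natCast, pow_succ']
          push_cast
          field_simp
        obtain ⟨T', R', hT'⟩ := ih (d + 1) _ R hR
          (fun e' he' => hle' e' (List.mem_append_right _ he')) ⟨2 * z + 1, hp'⟩
          -- The midpoint is an odd multiple of 2^(-(d+1)), so no standard interval of smaller depth
          -- can start there.
          (by linarith [hsucc d]) (by
            intro e' he'
            match R, hR with
            | [], _ => simp at he'
            | e'' :: R, hR =>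
              obtain rfl : e'' = e' := by simpa using he'
              obtain ⟨z', hz'⟩ := hR.1
              rw [hp', div_eq_div_iff (by positivity) (by positivity)] at hz'
              by_contra! hlt'
              obtain ⟨r, rfl⟩ := Nat.exists_eq_add_of_le (Nat.lt_succ_iff.1 hlt')
              have h3 : ((2 * z + 1) * 2 ^ e'' : ℤ) = z' * 2 ^ (e'' + r + 1) := by
                exact_mod_cast hz'
              have h4 : (2 * z + 1 : ℤ) * 2 ^ e'' = (2 * (z' * 2 ^ r)) * 2 ^ e'' := by
                rw [h3]
                ring
              have h5 := mul_right_cancel₀ (by positivity) h4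
              lia)
        refine ⟨.node () T T', R', ?_⟩
        rw [hT, hT']
        simp only [leafDepths, List.map_append, List.map_map, List.append_assoc, Function.comp_def]
        simp only [add_comm, add_left_comm]

/-- The tree all of whose leaves have depth `n`. -/
def fullTree : ℕ → BinaryTree Unit
  | 0 => .nil
  | n + 1 => .node () (fullTree n) (fullTree n)

theorem leafDepths_fullTree (n : ℕ) : leafDepths (fullTree n) = List.replicate (2 ^ n) n := by
  induction n with
  | zero => rfl
  | succ n ih =>
    rw [fullTree, leafDepths, ih, List.replicate_append_replicate, List.map_replicate, pow_succ,
      mul_two]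

theorem exists_represents {f : unitInterval ≃o unitInterval} (hf : f ∈ ThompsonF) :
    ∃ S T : BinaryTree Unit, Represents S T f := by
  obtain ⟨n, hn⟩ := exists_standard_dyadic_intervals hf
  choose! D z hz hD using hn
  have h2 : (0 : ℝ) < 2 ^ n := by positivity
  have hstep : ∀ j : ℕ, j < 2 ^ n → extendIso f (((j + 1 : ℕ) : ℝ) / 2 ^ n) =
      extendIso f ((j : ℝ) / 2 ^ n) + 2 ^ (-D j : ℤ) := by
    intro j hj
    push_cast
    rw [hD j hj _ ⟨by gcongr; linarith, le_rfl⟩, sub_eq_neg_add, zpow_add₀ (by norm_num),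
      zpow_natCast]
    field_simp
    ring
  have hAl : ∀ c j : ℕ, j + c ≤ 2 ^ n →
      Aligned (extendIso f ((j : ℝ) / 2 ^ n)) ((List.range' j c).map D) := by
    intro c
    induction c with
    | zero => intros; trivial
    | succ c ih =>
      intro j hj
      rw [List.range'_succ, List.map_cons]
      refine ⟨⟨z j, hz j (by lia)⟩, ?_⟩
      rw [← hstep j (by lia)]
      exact ih (j + 1) (by lia)
  have hsum : ∀ c j : ℕ, j + c ≤ 2 ^ n →
      (((List.range' j c).map D).map fun d : ℕ => (2 : ℝ) ^ (-d : ℤ)).sum =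
        extendIso f (((j + c : ℕ) : ℝ) / 2 ^ n) - extendIso f ((j : ℝ) / 2 ^ n) := by
    intro c
    induction c with
    | zero => simp
    | succ c ih =>
      intro j hj
      rw [List.range'_succ, List.map_cons, List.map_cons, List.sum_cons, ih (j + 1) (by lia),
        hstep j (by lia), show j + 1 + c = j + (c + 1) by ring]
      ring
  have hmap : ∀ c j : ℕ, j + c ≤ 2 ^ n → ∀ x : ℝ, (j : ℝ) / 2 ^ n ≤ x →
      x ≤ ((j + c : ℕ) : ℝ) / 2 ^ n →
      plMap ((List.range' j c).map fun i => (n, D i)) (x - j / 2 ^ n) =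
        extendIso f x - extendIso f ((j : ℝ) / 2 ^ n) := by
    intro c
    induction c with
    | zero =>
      intro j _ x h3 h4
      rw [add_zero] at h4
      rw [le_antisymm h4 h3, sub_self, sub_self]
      rfl
    | succ c ih =>
      intro j hj x h3 h4
      have e1 : ((j + 1 : ℕ) : ℝ) / 2 ^ n = j / 2 ^ n + 2 ^ (-n : ℤ) := by
        rw [zpow_neg, zpow_natCast]
        push_cast
        field_simp
      rw [List.range'_succ, List.map_cons, plMap]
      split_ifs with h5
      · rw [hD j (by lia) x ⟨h3, by push_cast at e1; rw [e1]; linarith⟩]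
        ring
      · have h6 := ih (j + 1) (by lia) x (by rw [e1]; linarith)
          (by rwa [show j + 1 + c = j + (c + 1) by ring])
        rw [e1, ← sub_sub, ← e1, hstep j (by lia)] at h6
        rw [h6]
        ring
  have e0 : ((0 : ℕ) : ℝ) / 2 ^ n = 0 := by simp
  have e1 : ((0 + 2 ^ n : ℕ) : ℝ) / 2 ^ n = 1 := by simp
  have hA := hAl (2 ^ n) 0 (by lia)
  have hS := hsum (2 ^ n) 0 (by lia)
  have hM := hmap (2 ^ n) 0 (by lia)
  rw [e0, e1, extendIso_zero, extendIso_one, sub_zero] at hS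
  rw [e0, extendIso_zero] at hA
  simp only [e0, e1, extendIso_zero, sub_zero] at hM
  obtain ⟨K, hK⟩ := ((Set.finite_lt_nat (2 ^ n)).image D).bddAbove
  obtain ⟨T, R, hT⟩ := hA.exists_leafDepths K 0 0 _ (by
    intro e he
    obtain ⟨i, hi, rfl⟩ := List.mem_map.1 he
    rw [zero_add]
    exact hK ⟨i, by simpa [List.mem_range'_1] using hi, rfl⟩) ⟨0, by simp⟩ (by rw [hS]; simp)
    (by simp)
  simp only [add_zero, List.map_id'] at hT
  -- The tree already accounts for the total length 1, and every further interval would have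
  -- positive length.
  have hR : R = [] := by
    rw [hT, List.map_append, List.sum_append, sum_leafDepths] at hS
    match R with
    | [] => rfl
    | e :: R =>
      have h0 : 0 ≤ (R.map fun d : ℕ => (2 : ℝ) ^ (-d : ℤ)).sum :=
        List.sum_nonneg (by simp only [List.mem_map]; rintro _ ⟨a, _, rfl⟩; positivity)
      have h0' : (0 : ℝ) < 2 ^ (-e : ℤ) := by positivity
      rw [List.map_cons, List.sum_cons] at hS
      linarith
  rw [hR, List.append_nil] at hT
  refine ⟨fullTree n, T, ?_, fun x => ?_⟩
  · have h3 := length_leafDepths (fullTree n)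
    have h4 := length_leafDepths T
    rw [leafDepths_fullTree, List.length_replicate] at h3
    rw [← hT, List.length_map, List.length_range'] at h4
    lia
  · have h5 : (List.range' 0 (2 ^ n)).map (fun i => (n, D i)) =
        (leafDepths (fullTree n)).zip (leafDepths T) := by
      rw [← hT, leafDepths_fullTree]
      have : List.replicate (2 ^ n) n = (List.range' 0 (2 ^ n)).map fun _ => n := by
        rw [List.map_const', List.length_range']
      rw [this, List.zip_map']
    rw [← h5, hM x x.2.1 x.2.2, extendIso_coe]

theorem thompsonF_le_standardSubgroup : ThompsonF ≤ standardSubgroup := by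
  intro f hf
  obtain ⟨S, T, h⟩ := exists_represents hf
  exact h.mem_standardSubgroup

theorem Represents.toOrderIso_eq {p : ReducedTreePair} {f : unitInterval ≃o unitInterval}
    (h : Represents p.source p.target f) : p.toOrderIso = f :=
  (represents_toOrderIso p).unique h

theorem rotationIso_mem_thompsonF : rotationIso ∈ ThompsonF := rotationPair.toOrderIso_mem

theorem rotationIso'_mem_thompsonF : rotationIso' ∈ ThompsonF := by
  let p : ReducedTreePair :=
    { source := .node () .nil (.node () (.node () .nil .nil) .nil)
      target := .node () .nil (.node () .nil (.node () .nil .nil))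
      numNodes_eq := rfl
      numNodes_pos := by decide
      reduced := Or.inr (by decide) }
  rw [← Represents.toOrderIso_eq (p := p) (represents_rotationIso' .nil .nil .nil .nil)]
  exact p.toOrderIso_mem

theorem standardSubgroup_eq_thompsonF : standardSubgroup = ThompsonF := by
  refine le_antisymm ?_ thompsonF_le_standardSubgroup
  rw [standardSubgroup, Subgroup.closure_le]
  rintro g (rfl | rfl)
  · exact rotationIso_mem_thompsonF
  · exact rotationIso'_mem_thompsonF

theorem juxtapose_mem_thompsonF {f g : unitInterval ≃o unitInterval} (hf : f ∈ ThompsonF)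
    (hg : g ∈ ThompsonF) : juxtapose f g ∈ ThompsonF := by
  rw [← standardSubgroup_eq_thompsonF] at *
  exact juxtapose_mem hf hg

/-! ### Slopes at the endpoints -/

/-- Near the zero of the coordinate `u`, the homeomorphism `f` is multiplication of `u` by
`2 ^ m`. -/
def HasEndSlope (u : unitInterval → ℝ) (f : unitInterval ≃o unitInterval) (m : ℤ) : Prop :=
  ∃ δ : ℝ, 0 < δ ∧ ∀ x, u x ≤ δ → u (f x) = 2 ^ m * u x

theorem HasEndSlope.mul {u : unitInterval → ℝ} {f g : unitInterval ≃o unitInterval} {m n : ℤ}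
    (hf : HasEndSlope u f m) (hg : HasEndSlope u g n) : HasEndSlope u (f * g) (m + n) := by
  obtain ⟨δ, hδ, hf⟩ := hf
  obtain ⟨ε, hε, hg⟩ := hg
  have h2 : (0 : ℝ) < 2 ^ n := by positivity
  refine ⟨min ε (δ / 2 ^ n), by positivity, fun x hx => ?_⟩
  have h3 := hg x (hx.trans (min_le_left _ _))
  have h4 := (le_div_iff₀ h2).1 (hx.trans (min_le_right _ _))
  rw [RelIso.mul_apply, hf _ (by rw [h3]; linarith), h3, zpow_add₀ (by norm_num), mul_assoc]

theorem HasEndSlope.unique {u : unitInterval → ℝ} (hu : ∀ δ > 0, ∃ x, 0 < u x ∧ u x ≤ δ)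
    {f : unitInterval ≃o unitInterval} {m n : ℤ} (hf : HasEndSlope u f m)
    (hg : HasEndSlope u f n) : m = n := by
  obtain ⟨δ, hδ, hf⟩ := hf
  obtain ⟨ε, hε, hg⟩ := hg
  obtain ⟨x, hx, hx'⟩ := hu (min δ ε) (by positivity)
  have h := (hf x (hx'.trans (min_le_left _ _))).symm.trans (hg x (hx'.trans (min_le_right _ _)))
  exact zpow_right_injective₀ (by norm_num) (by norm_num) (mul_right_cancel₀ hx.ne' h)

/-- The binary logarithm of the slope at the zero of `u`, as a homomorphism. -/
noncomputable def endSlopeHom (u : unitInterval → ℝ) (hu : ∀ δ > 0, ∃ x, 0 < u x ∧ u x ≤ δ)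
    (h : ∀ f ∈ ThompsonF, ∃ m, HasEndSlope u f m) : ThompsonF →* Multiplicative ℤ where
  toFun f := Multiplicative.ofAdd (h f f.2).choose
  map_one' := HasEndSlope.unique hu (h _ (one_mem _)).choose_spec
    ⟨1, one_pos, fun x _ => by
      change u x = 2 ^ (0 : ℤ) * u x
      rw [zpow_zero, one_mul]⟩
  map_mul' f g := HasEndSlope.unique hu (h _ (f * g).2).choose_spec
    ((h f f.2).choose_spec.mul (h g g.2).choose_spec)

theorem endSlopeHom_apply {u : unitInterval → ℝ} (hu : ∀ δ > 0, ∃ x, 0 < u x ∧ u x ≤ δ)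
    (h : ∀ f ∈ ThompsonF, ∃ m, HasEndSlope u f m) {f : ThompsonF} {m : ℤ}
    (hf : HasEndSlope u f m) : endSlopeHom u hu h f = Multiplicative.ofAdd m :=
  HasEndSlope.unique hu (h f f.2).choose_spec hf

theorem exists_left_slope {f : unitInterval ≃o unitInterval} (hf : f ∈ ThompsonF) :
    ∃ m, HasEndSlope (fun x => x) f m := by
  obtain ⟨N, hN⟩ := exists_affine_on_dyadic_intervals hf
  obtain ⟨m, q, -, h⟩ := hN 0 (by positivity)
  simp only [Nat.cast_zero, zero_div, zero_add] at h
  have h0 := h 0 ⟨le_rfl, by positivity⟩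
  rw [extendIso_zero] at h0
  refine ⟨m, 1 / 2 ^ N, by positivity, fun x hx => ?_⟩
  have := h x ⟨x.2.1, hx⟩
  rw [extendIso_coe] at this
  simp only [this]
  linarith

theorem exists_right_slope {f : unitInterval ≃o unitInterval} (hf : f ∈ ThompsonF) :
    ∃ m, HasEndSlope (fun x => 1 - x) f m := by
  obtain ⟨N, hN⟩ := exists_affine_on_dyadic_intervals hf
  have hN1 : 1 ≤ 2 ^ N := Nat.one_le_two_pow
  obtain ⟨m, q, -, h⟩ := hN (2 ^ N - 1) (by lia)
  push_cast [hN1] at h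
  have h2 : (0 : ℝ) < 2 ^ N := by positivity
  rw [sub_add_cancel, div_self h2.ne', sub_div, div_self h2.ne'] at h
  have h0 := h 1 ⟨by linarith [show (0 : ℝ) < 1 / 2 ^ N by positivity], le_rfl⟩
  rw [extendIso_one] at h0
  refine ⟨m, 1 / 2 ^ N, by positivity, fun x hx => ?_⟩
  have := h x ⟨by linarith, x.2.2⟩
  rw [extendIso_coe] at this
  simp only [this]
  linarith

theorem exists_small_left (δ : ℝ) (hδ : δ > 0) : ∃ x : unitInterval, 0 < (x : ℝ) ∧ (x : ℝ) ≤ δ :=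
  ⟨⟨min δ 1, by positivity, min_le_right _ _⟩, by dsimp only; positivity, min_le_left _ _⟩

theorem exists_small_right (δ : ℝ) (hδ : δ > 0) :
    ∃ x : unitInterval, 0 < 1 - (x : ℝ) ∧ 1 - (x : ℝ) ≤ δ :=
  ⟨⟨1 - min δ 1, by linarith [min_le_right δ 1], by linarith [show 0 < min δ 1 by positivity]⟩,
    by dsimp only; linarith [show 0 < min δ 1 by positivity],
    by dsimp only; linarith [min_le_left δ 1]⟩

/-- The binary logarithm of the slope at `0`. -/
noncomputable def leftSlope : ThompsonF →* Multiplicative ℤ :=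
  endSlopeHom (fun x => x) exists_small_left fun _ => exists_left_slope

/-- The binary logarithm of the slope at `1`. -/
noncomputable def rightSlope : ThompsonF →* Multiplicative ℤ :=
  endSlopeHom (fun x => 1 - x) exists_small_right fun _ => exists_right_slope

theorem leftSlope_eq {f : ThompsonF} {m : ℤ} (hf : HasEndSlope (fun x => x) f m) :
    leftSlope f = Multiplicative.ofAdd m := endSlopeHom_apply _ _ hf

theorem rightSlope_eq {f : ThompsonF} {m : ℤ} (hf : HasEndSlope (fun x => 1 - x) f m) :
    rightSlope f = Multiplicative.ofAdd m := endSlopeHom_apply _ _ hf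

theorem hasEndSlope_one (u : unitInterval → ℝ) : HasEndSlope u 1 0 :=
  ⟨1, one_pos, fun x _ => by simp⟩

theorem HasEndSlope.juxtapose_left {f : unitInterval ≃o unitInterval} {m : ℤ}
    (hf : HasEndSlope (fun x => x) f m) (g : unitInterval ≃o unitInterval) :
    HasEndSlope (fun x => x) (juxtapose f g) m := by
  obtain ⟨δ, hδ, h⟩ := hf
  refine ⟨min (δ / 2) (1 / 2), by positivity, fun x hx => ?_⟩
  have h1 := hx.trans (min_le_left _ _)
  have h2 := hx.trans (min_le_right _ _)
  have h3 := x.2.1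
  have := h ⟨2 * x, by linarith, by linarith⟩ (by dsimp only; linarith)
  dsimp only at this ⊢
  rw [juxtapose_of_le _ _ h2, Set.projIcc_of_mem zero_le_one ⟨by linarith, by linarith⟩, this]
  ring

theorem HasEndSlope.juxtapose_right {g : unitInterval ≃o unitInterval} {m : ℤ}
    (hg : HasEndSlope (fun x => 1 - x) g m) (f : unitInterval ≃o unitInterval) :
    HasEndSlope (fun x => 1 - x) (juxtapose f g) m := by
  obtain ⟨δ, hδ, h⟩ := hg
  refine ⟨min (δ / 2) (1 / 2), by positivity, fun x hx => ?_⟩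
  have h1 := hx.trans (min_le_left _ _)
  have h2 := hx.trans (min_le_right _ _)
  have h3 := x.2.2
  have := h ⟨2 * x - 1, by linarith, by linarith⟩ (by dsimp only; linarith)
  dsimp only at this ⊢
  rw [juxtapose_of_ge _ _ (by linarith), Set.projIcc_of_mem zero_le_one ⟨by linarith, by linarith⟩]
  linarith

theorem rotationIso_apply (x : unitInterval) :
    (rotationIso x : ℝ) = plMap [(2, 1), (2, 2), (1, 2)] x := rfl

theorem leftSlope_rotationIso : HasEndSlope (fun x => x) rotationIso 1 := by
  refine ⟨1 / 4, by norm_num, fun x hx => ?_⟩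
  simp only [rotationIso_apply, plMap]
  rw [if_pos (by norm_num; linarith)]
  norm_num

theorem rightSlope_rotationIso : HasEndSlope (fun x => 1 - x) rotationIso (-1) := by
  refine ⟨1 / 4, by norm_num, fun x hx => ?_⟩
  have h1 := x.2.2
  simp only [rotationIso_apply, plMap]
  rw [if_neg (by norm_num; linarith), if_neg (by norm_num; linarith),
    if_pos (by norm_num; linarith)]
  norm_num
  ring

/-! ### Tuples that generate a copy of Thompson's group -/

/-- Corresponding subtrees have equally many leaves, so leaf numbers do not mix between left and
right. The positivity hypothesis keeps the root carets from being exposed. -/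
theorem disjoint_exposedCarets_node {l r l' r' : BinaryTree Unit} (hl : l.numNodes = l'.numNodes)
    (hr : r.numNodes = r'.numNodes) (h : 0 < l.numNodes ∨ 0 < r.numNodes)
    (hdl : Disjoint (exposedCarets l) (exposedCarets l'))
    (hdr : Disjoint (exposedCarets r) (exposedCarets r')) :
    Disjoint (exposedCarets (.node () l r)) (exposedCarets (.node () l' r')) := by
  rw [Finset.disjoint_left]
  intro i hi hi'
  rw [mem_exposedCarets_node] at hi hi'
  simp only [BinaryTree.numLeaves_eq_numNodes_succ] at hi hi'
  rcases hi with ⟨rfl, rfl, -⟩ | hi | ⟨j, hj, rfl⟩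
  · simp at h
  · rcases hi' with ⟨rfl, rfl, -⟩ | hi' | ⟨j', hj', hj''⟩
    · simp at hl hr
      lia
    · exact Finset.disjoint_left.1 hdl hi hi'
    · have := lt_of_mem_exposedCarets hi
      lia
  · rcases hi' with ⟨rfl, rfl, -⟩ | hi' | ⟨j', hj', hj''⟩
    · simp at hl hr
      lia
    · have := lt_of_mem_exposedCarets hi'
      lia
    · obtain rfl : j' = j := by lia
      exact Finset.disjoint_left.1 hdr hj hj'

/-- The reduced tree pairs other than the pair of single carets. -/
def ProperPair : Type :=
  {p : ReducedTreePair // Disjoint (exposedCarets p.source) (exposedCarets p.target)}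

namespace ProperPair

/-- The tree pair that acts as `x₀` on the left half and as `p` on the third quarter. -/
def first (p : ProperPair) : ReducedTreePair where
  source := .node () (.node () (.node () .nil .nil) .nil) (.node () p.1.source .nil)
  target := .node () (.node () .nil (.node () .nil .nil)) (.node () p.1.target .nil)
  numNodes_eq := by simp [p.1.numNodes_eq]
  numNodes_pos := by simp
  reduced := Or.inr <| disjoint_exposedCarets_node rfl (by simp [p.1.numNodes_eq]) (by simp)
    (by decide) (disjoint_exposedCarets_node p.1.numNodes_eq rfl (Or.inl p.1.numNodes_pos) p.2
      (by simp [exposedCarets]))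

/-- The tree pair that acts as `x₁` on the left half and as `p` on the last quarter. -/
def second (p : ProperPair) : ReducedTreePair where
  source := .node () (.node () .nil (.node () (.node () .nil .nil) .nil))
    (.node () .nil p.1.source)
  target := .node () (.node () .nil (.node () .nil (.node () .nil .nil)))
    (.node () .nil p.1.target)
  numNodes_eq := by simp [p.1.numNodes_eq]
  numNodes_pos := by simp
  reduced := Or.inr <| disjoint_exposedCarets_node rfl (by simp [p.1.numNodes_eq]) (by simp)
    (by decide) (disjoint_exposedCarets_node rfl p.1.numNodes_eq (Or.inr p.1.numNodes_pos)
      (by simp [exposedCarets]) p.2)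

/-- The tree pair that acts as `p` on the third eighth and is the identity elsewhere. -/
def center (p : ProperPair) : ReducedTreePair where
  source := .node () (.node () .nil (.node () p.1.source .nil)) .nil
  target := .node () (.node () .nil (.node () p.1.target .nil)) .nil
  numNodes_eq := by simp [p.1.numNodes_eq]
  numNodes_pos := by simp
  reduced := Or.inr <| disjoint_exposedCarets_node (by simp [p.1.numNodes_eq]) rfl (by simp)
    (disjoint_exposedCarets_node rfl (by simp [p.1.numNodes_eq]) (by simp) (by simp [exposedCarets])
      (disjoint_exposedCarets_node p.1.numNodes_eq rfl (Or.inl p.1.numNodes_pos) p.2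
        (by simp [exposedCarets]))) (by simp [exposedCarets])

theorem size_first (p : ProperPair) : p.first.size = p.1.size + 4 := by
  simp only [ReducedTreePair.size, first, BinaryTree.numNodes]
  ring

theorem size_second (p : ProperPair) : p.second.size = p.1.size + 5 := by
  simp only [ReducedTreePair.size, second, BinaryTree.numNodes]
  ring

theorem size_center (p : ProperPair) : p.center.size = p.1.size + 3 := by
  simp only [ReducedTreePair.size, center, BinaryTree.numNodes]
  ring

theorem toOrderIso_first (p : ProperPair) :
    p.first.toOrderIso = juxtapose rotationIso (juxtapose p.1.toOrderIso 1) :=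
  Represents.toOrderIso_eq ((represents_rotation _ _ _).juxtapose
    ((represents_toOrderIso p.1).juxtapose (Represents.refl _)))

theorem toOrderIso_second (p : ProperPair) :
    p.second.toOrderIso = juxtapose rotationIso' (juxtapose 1 p.1.toOrderIso) :=
  Represents.toOrderIso_eq ((represents_rotationIso' _ _ _ _).juxtapose
    ((Represents.refl _).juxtapose (represents_toOrderIso p.1)))

theorem toOrderIso_center (p : ProperPair) :
    p.center.toOrderIso = juxtapose (juxtapose 1 (juxtapose p.1.toOrderIso 1)) 1 :=
  Represents.toOrderIso_eq (((Represents.refl _).juxtapose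
    ((represents_toOrderIso p.1).juxtapose (Represents.refl _))).juxtapose (Represents.refl _))

end ProperPair

/-! ### Twisted copies of Thompson's group inside itself -/

/-- The exponent sum homomorphism that vanishes on `x₀` and is `1` on `x₁`. -/
noncomputable def secondExponent : ThompsonF →* Multiplicative ℤ := (leftSlope * rightSlope)⁻¹

/-- The homomorphism that juxtaposes with `w` powers of `f` and `g` whose exponents are the two
exponent sums of `w`. -/
noncomputable def twistedHom (f g : ThompsonF) : ThompsonF →* ThompsonF :=
  (juxtaposeHom.comp (ThompsonF.subtype.prod (juxtaposeHom.comp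
    (((zpowersHom _ (f : unitInterval ≃o unitInterval)).comp leftSlope).prod
      ((zpowersHom _ (g : unitInterval ≃o unitInterval)).comp secondExponent))))).codRestrict
    ThompsonF fun w => juxtapose_mem_thompsonF w.2
      (juxtapose_mem_thompsonF (zpow_mem f.2 _) (zpow_mem g.2 _))

theorem coe_twistedHom (f g w : ThompsonF) {m n : ℤ}
    (hm : HasEndSlope (fun x => x) (w : unitInterval ≃o unitInterval) m)
    (hn : HasEndSlope (fun x => 1 - x) (w : unitInterval ≃o unitInterval) n) :
    (twistedHom f g w : unitInterval ≃o unitInterval) =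
      juxtapose w (juxtapose (f ^ m : ThompsonF) (g ^ (-(m + n)) : ThompsonF)) := by
  change juxtapose w (juxtapose (zpowersHom _ _ (leftSlope w))
    (zpowersHom _ _ (leftSlope w * rightSlope w)⁻¹)) = _
  rw [leftSlope_eq hm, rightSlope_eq hn]
  rfl

theorem twistedHom_injective (f g : ThompsonF) : Function.Injective (twistedHom f g) :=
  fun _ _ h => Subtype.ext (juxtapose_injective (congrArg Subtype.val h)).1

/-- The first two components are the images of x₀ and x₁, whose exponent sums are (1, 0) and (0, 1),
and already generate the range. The remaining components lie in it because they come from elements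
with slope 1 at both endpoints, for which the twist is trivial. -/
theorem generatedSubgroup_eq_range {k : ℕ} (p q : ProperPair) (s : Sym ProperPair k) :
    generatedSubgroup (p.first ::ₛ q.second ::ₛ s.map ProperPair.center) =
      (twistedHom p.1.toF q.1.toF).range := by
  have h0 : twistedHom p.1.toF q.1.toF ⟨rotationIso, rotationIso_mem_thompsonF⟩ = p.first.toF := by
    apply Subtype.ext
    rw [coe_twistedHom _ _ _ leftSlope_rotationIso rightSlope_rotationIso]
    simp only [add_neg_cancel, neg_zero, zpow_zero, zpow_one]
    exact p.toOrderIso_first.symm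
  have h1 : twistedHom p.1.toF q.1.toF ⟨rotationIso', rotationIso'_mem_thompsonF⟩ =
      q.second.toF := by
    apply Subtype.ext
    rw [coe_twistedHom _ _ _ ((hasEndSlope_one _).juxtapose_left _)
      (rightSlope_rotationIso.juxtapose_right _)]
    simp only [zero_add, neg_neg, zpow_zero, zpow_one]
    exact q.toOrderIso_second.symm
  have h2 : ∀ r : ProperPair, ∃ w, twistedHom p.1.toF q.1.toF w = r.center.toF := by
    intro r
    refine ⟨⟨juxtapose 1 (juxtapose r.1.toOrderIso 1), juxtapose_mem_thompsonF (one_mem _)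
      (juxtapose_mem_thompsonF r.1.toOrderIso_mem (one_mem _))⟩, ?_⟩
    apply Subtype.ext
    rw [coe_twistedHom _ _ _ ((hasEndSlope_one _).juxtapose_left _)
      (((hasEndSlope_one _).juxtapose_right _).juxtapose_right _)]
    simp only [add_zero, neg_zero, zpow_zero]
    refine Eq.trans ?_ r.toOrderIso_center.symm
    exact congrArg _ juxtapose_one
  apply le_antisymm
  · rw [generatedSubgroup, Subgroup.closure_le]
    rintro _ ⟨t, ht, rfl⟩
    rw [Sym.mem_cons, Sym.mem_cons, Sym.mem_map] at ht
    rcases ht with rfl | rfl | ⟨r, -, rfl⟩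
    · exact ⟨_, h0⟩
    · exact ⟨_, h1⟩
    · exact h2 r
  · rintro _ ⟨w, rfl⟩
    -- The elements of F whose images are generated by the tuple, viewed among all homeomorphisms so
    -- that generation by x₀ and x₁ applies.
    let K := ((generatedSubgroup (p.first ::ₛ q.second ::ₛ s.map ProperPair.center)).comap
      (twistedHom p.1.toF q.1.toF)).map ThompsonF.subtype
    have hK : standardSubgroup ≤ K := by
      rw [standardSubgroup, Subgroup.closure_le]
      rintro g (rfl | rfl)
      · refine ⟨⟨rotationIso, rotationIso_mem_thompsonF⟩, ?_, rfl⟩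
        refine Subgroup.subset_closure ⟨p.first, Sym.mem_cons_self _ _, h0.symm⟩
      · refine ⟨⟨rotationIso', rotationIso'_mem_thompsonF⟩, ?_, rfl⟩
        refine Subgroup.subset_closure ⟨q.second, Sym.mem_cons_of_mem (Sym.mem_cons_self _ _),
          h1.symm⟩
    obtain ⟨w', hw', he⟩ := hK (thompsonF_le_standardSubgroup w.2)
    obtain rfl : w' = w := Subtype.ext he
    exact hw'

theorem mem_generatingTuples {k : ℕ} (p q : ProperPair) (s : Sym ProperPair k) :
    (p.first ::ₛ q.second ::ₛ s.map ProperPair.center) ∈ generatingTuples (k + 2) ⊤ := by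
  change Nonempty (generatedSubgroup _ ≃* _)
  rw [generatedSubgroup_eq_range]
  exact ⟨(MonoidHom.ofInjective (twistedHom_injective _ _)).symm.trans Subgroup.topEquiv.symm⟩

/-! ### Counting tuples -/

theorem ReducedTreePair.eq_of_trees_eq {p q : ReducedTreePair} (h : p.source = q.source)
    (h' : p.target = q.target) : p = q := by
  cases p
  cases q
  simp only at h h'
  subst h h'
  rfl

/-- The number of proper reduced tree pairs with at most `n` carets. -/
def ballCount (n : ℕ) : ℕ := ∑ i ∈ Finset.range n, reducedCount (i + 1)

theorem ProperPair.trees_injective :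
    Function.Injective fun p : ProperPair => (p.1.source, p.1.target) := by
  intro p q h
  rw [Prod.mk.injEq] at h
  exact Subtype.ext (ReducedTreePair.eq_of_trees_eq h.1 h.2)

theorem image_properPair {n : ℕ} (hn : 0 < n) :
    (fun p : ProperPair => (p.1.source, p.1.target)) '' {p | p.1.size = n} =
      ↑(disjointPairs n n) := by
  ext ⟨S, T⟩
  rw [Finset.mem_coe, mem_disjointPairs_self]
  constructor
  · rintro ⟨p, hp, h⟩
    obtain ⟨rfl, rfl⟩ := Prod.mk.inj h
    exact ⟨⟨hp, p.1.numNodes_eq ▸ hp⟩, p.2⟩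
  · rintro ⟨⟨h1, h2⟩, h3⟩
    exact ⟨⟨⟨S, T, h1.trans h2.symm, h1 ▸ hn, Or.inr h3⟩, h3⟩, h1, rfl⟩

theorem ncard_properPair_eq {n : ℕ} (hn : 0 < n) :
    {p : ProperPair | p.1.size = n}.ncard = reducedCount n := by
  rw [← Set.ncard_image_of_injective _ ProperPair.trees_injective, image_properPair hn,
    Set.ncard_coe_finset, reducedCount]

theorem finite_properPair_eq (n : ℕ) : {p : ProperPair | p.1.size = n}.Finite := by
  rcases n.eq_zero_or_pos with rfl | hn
  · convert Set.finite_empty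
    exact Set.eq_empty_of_forall_notMem fun p (hp : p.1.size = 0) => p.1.numNodes_pos.ne' hp
  · refine Set.Finite.of_finite_image (f := fun p => (p.1.source, p.1.target)) ?_
      ProperPair.trees_injective.injOn
    rw [image_properPair hn]
    exact Finset.finite_toSet _

theorem setOf_properPair_le_succ (n : ℕ) : {p : ProperPair | p.1.size ≤ n + 1} =
    {p | p.1.size ≤ n} ∪ {p | p.1.size = n + 1} := by
  ext p
  exact Nat.le_succ_iff

theorem ncard_properPair_le (n : ℕ) : {p : ProperPair | p.1.size ≤ n}.Finite ∧
    {p : ProperPair | p.1.size ≤ n}.ncard = ballCount n := by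
  induction n with
  | zero =>
    have h : {p : ProperPair | p.1.size ≤ 0} = ∅ :=
      Set.eq_empty_of_forall_notMem fun p hp => p.1.numNodes_pos.ne' (Nat.le_zero.1 hp)
    rw [h]
    simp [ballCount]
  | succ n ih =>
    rw [setOf_properPair_le_succ]
    refine ⟨ih.1.union (finite_properPair_eq _), ?_⟩
    rw [Set.ncard_union_eq ?_ ih.1 (finite_properPair_eq _), ih.2, ncard_properPair_eq n.succ_pos,
      ballCount, ballCount, Finset.sum_range_succ]
    refine Set.disjoint_left.2 fun p (hp : p.1.size ≤ n) (hp' : p.1.size = n + 1) => ?_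
    lia

theorem eq_caret_of_numNodes_eq_one {T : BinaryTree Unit} (h : T.numNodes = 1) :
    T = .node () .nil .nil := by
  match T, h with
  | .node _ .nil .nil, _ => rfl
  | .node _ (.node _ _ _) r, h => simp at h
  | .node _ .nil (.node _ _ _), h => simp at h

theorem reducedTreePair_le_subset (n : ℕ) : ∃ q : ReducedTreePair,
    {p : ReducedTreePair | p.size ≤ n} ⊆
      insert q ((Subtype.val : ProperPair → ReducedTreePair) '' {p | p.1.size ≤ n}) := by
  refine ⟨⟨.node () .nil .nil, .node () .nil .nil, rfl, by decide, Or.inl rfl⟩, fun p hp => ?_⟩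
  rcases p.reduced with h | h
  · left
    exact ReducedTreePair.eq_of_trees_eq (eq_caret_of_numNodes_eq_one h)
      (eq_caret_of_numNodes_eq_one (p.numNodes_eq ▸ h))
  · exact Or.inr ⟨⟨p, h⟩, hp, rfl⟩

theorem ncard_reducedTreePair_le (n : ℕ) : {p : ReducedTreePair | p.size ≤ n}.Finite ∧
    {p : ReducedTreePair | p.size ≤ n}.ncard ≤ ballCount n + 1 := by
  obtain ⟨q, hq⟩ := reducedTreePair_le_subset n
  have hfin := (ncard_properPair_le n).1.image (Subtype.val : ProperPair → ReducedTreePair)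
  refine ⟨(hfin.insert q).subset hq, ?_⟩
  refine (Set.ncard_le_ncard hq (hfin.insert q)).trans ((Set.ncard_insert_le _ _).trans ?_)
  exact Nat.succ_le_succ ((Set.ncard_image_of_injective _ Subtype.val_injective).trans
    (ncard_properPair_le n).2).le

theorem ncard_reducedTreePair_eq_le {n : ℕ} (hn : 2 ≤ n) :
    {p : ReducedTreePair | p.size = n}.Finite ∧
      {p : ReducedTreePair | p.size = n}.ncard ≤ reducedCount n := by
  have hsub : {p : ReducedTreePair | p.size = n} ⊆
      (Subtype.val : ProperPair → ReducedTreePair) '' {p | p.1.size = n} := by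
    intro p (hp : p.source.numNodes = n)
    rcases p.reduced with h | h
    · lia
    · exact ⟨⟨p, h⟩, hp, rfl⟩
  have hfin := (finite_properPair_eq n).image (Subtype.val : ProperPair → ReducedTreePair)
  refine ⟨hfin.subset hsub, (Set.ncard_le_ncard hsub hfin).trans ?_⟩
  exact ((Set.ncard_image_of_injective _ Subtype.val_injective).trans
    (ncard_properPair_eq (by lia))).le

theorem card_sym_set {α : Type*} {A : Set α} (hA : A.Finite) (k : ℕ) :
    Finite (Sym A k) ∧ Nat.card (Sym A k) = Nat.multichoose A.ncard k := by
  classical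
  have := hA.fintype
  refine ⟨inferInstance, ?_⟩
  rw [Nat.card_eq_fintype_card, Sym.card_sym_eq_multichoose, ← Nat.card_eq_fintype_card,
    Nat.card_coe_set_eq]

/-- One component of size n is singled out, and the others form an arbitrary multiset of pairs of
size at most n. The extra 1 accounts for the pair of single carets, which is not a `ProperPair`. -/
theorem ncard_sphMax_le {k n : ℕ} (hn : 2 ≤ n) :
    (sphMax (k + 1) n).ncard ≤ reducedCount n * Nat.multichoose (ballCount n + 1) k := by
  let A := {p : ReducedTreePair | p.size ≤ n}
  have hA := ncard_reducedTreePair_le n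
  have hE := ncard_reducedTreePair_eq_le hn
  obtain ⟨hS, hS'⟩ := card_sym_set hA.1 k
  have hsub : sphMax (k + 1) n ⊆ (fun x : ReducedTreePair × Sym A k =>
      x.1 ::ₛ x.2.map Subtype.val) '' ({p | p.size = n} ×ˢ Set.univ) := by
    rintro s ⟨hs, p, hp, hpn⟩
    obtain ⟨t, rfl⟩ := Sym.exists_cons_of_mem hp
    refine ⟨(p, t.attach.map fun x => ⟨x.1, hs x.1 (Sym.mem_cons_of_mem x.2)⟩), ⟨hpn, trivial⟩, ?_⟩
    simp only [Sym.map_map]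
    congr 1
    exact t.attach_map_coe
  have hfin : (({p | p.size = n} : Set ReducedTreePair) ×ˢ (Set.univ : Set (Sym A k))).Finite :=
    hE.1.prod Set.finite_univ
  refine (Set.ncard_le_ncard hsub (hfin.image _)).trans ((Set.ncard_image_le hfin).trans ?_)
  rw [Set.ncard_prod, Set.ncard_univ, hS']
  refine Nat.mul_le_mul hE.2 ?_
  rw [Nat.multichoose_eq, Nat.multichoose_eq]
  exact Nat.choose_le_choose k (by have := hA.2; lia)

namespace ProperPair

theorem first_injective : Function.Injective first := by
  intro p q h
  have h1 := congrArg ReducedTreePair.source h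
  have h2 := congrArg ReducedTreePair.target h
  simp only [first, BinaryTree.node.injEq, true_and, and_true] at h1 h2
  exact Subtype.ext (ReducedTreePair.eq_of_trees_eq h1 h2)

theorem second_injective : Function.Injective second := by
  intro p q h
  have h1 := congrArg ReducedTreePair.source h
  have h2 := congrArg ReducedTreePair.target h
  simp only [second, BinaryTree.node.injEq, true_and] at h1 h2
  exact Subtype.ext (ReducedTreePair.eq_of_trees_eq h1 h2)

theorem center_injective : Function.Injective center := by
  intro p q h
  have h1 := congrArg ReducedTreePair.source h
  have h2 := congrArg ReducedTreePair.target h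
  simp only [center, BinaryTree.node.injEq, true_and, and_true] at h1 h2
  exact Subtype.ext (ReducedTreePair.eq_of_trees_eq h1 h2)

theorem first_ne_second (p q : ProperPair) : p.first ≠ q.second := fun h => by
  have := congrArg ReducedTreePair.source h
  simp [first, second] at this

theorem first_ne_center (p q : ProperPair) : p.first ≠ q.center := fun h => by
  have := congrArg ReducedTreePair.source h
  simp [first, center] at this

theorem second_ne_center (p q : ProperPair) : p.second ≠ q.center := fun h => by
  have := congrArg ReducedTreePair.source h
  simp [second, center] at this

/-- The shapes of the source trees near the root tell the three kinds of components apart, so even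
the unordered tuple determines the data. -/
theorem tuple_injective {k : ℕ} {p q p' q' : ProperPair} {s s' : Sym ProperPair k}
    (h : p.first ::ₛ q.second ::ₛ s.map center = p'.first ::ₛ q'.second ::ₛ s'.map center) :
    p = p' ∧ q = q' ∧ s = s' := by
  have h1 : p = p' := by
    have hm : p.first ∈ p'.first ::ₛ q'.second ::ₛ s'.map center := h ▸ Sym.mem_cons_self _ _
    rw [Sym.mem_cons, Sym.mem_cons, Sym.mem_map] at hm
    rcases hm with hm | hm | ⟨r, -, hm⟩
    · exact first_injective hm
    · exact absurd hm (first_ne_second _ _)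
    · exact absurd hm.symm (first_ne_center _ _)
  subst h1
  rw [Sym.cons_inj_right] at h
  have h2 : q = q' := by
    have hm : q.second ∈ q'.second ::ₛ s'.map center := h ▸ Sym.mem_cons_self _ _
    rw [Sym.mem_cons, Sym.mem_map] at hm
    rcases hm with hm | ⟨r, -, hm⟩
    · exact second_injective hm
    · exact absurd hm.symm (second_ne_center _ _)
  subst h2
  rw [Sym.cons_inj_right] at h
  exact ⟨rfl, rfl, Sym.map_injective center_injective k h⟩

end ProperPair

/-- The sizes n + 1, at most n and at most n + 2 become n + 5 or at most n + 5 after adding 4, 5 and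
3 carets. The first component attains the maximum. -/
theorem le_ncard_generatingTuples (k n : ℕ) :
    reducedCount (n + 1) * (ballCount n * Nat.multichoose (ballCount (n + 2)) k) ≤
      (generatingTuples (k + 2) ⊤ ∩ sphMax (k + 2) (n + 5)).ncard := by
  let A := {p : ProperPair | p.1.size ≤ n + 2}
  obtain ⟨hS, hS'⟩ := card_sym_set (ncard_properPair_le (n + 2)).1 k
  rw [← ncard_properPair_eq n.succ_pos, ← (ncard_properPair_le n).2,
    ← (ncard_properPair_le (n + 2)).2, ← hS', ← Set.ncard_univ, ← Set.ncard_prod, ← Set.ncard_prod]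
  let Φ : ProperPair × ProperPair × Sym A k → Sym ReducedTreePair (k + 2) := fun x =>
    x.1.first ::ₛ x.2.1.second ::ₛ (x.2.2.map Subtype.val).map ProperPair.center
  have hΦ : Function.Injective Φ := by
    rintro ⟨p, q, s⟩ ⟨p', q', s'⟩ h
    obtain ⟨rfl, rfl, h⟩ := ProperPair.tuple_injective h
    obtain rfl : s = s' := Sym.map_injective Subtype.val_injective k h
    rfl
  rw [← Set.ncard_image_of_injective _ hΦ]
  refine Set.ncard_le_ncard ?_ ((sphMax_finite _ _).subset Set.inter_subset_right)
  rintro _ ⟨⟨p, q, s⟩, ⟨hp, hq, -⟩, rfl⟩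
  refine ⟨mem_generatingTuples _ _ _, fun t ht => ?_, p.first, Sym.mem_cons_self _ _, ?_⟩
  · change p.1.size = n + 1 at hp
    change q.1.size ≤ n at hq
    rw [Sym.mem_cons, Sym.mem_cons, Sym.map_map, Sym.mem_map] at ht
    rcases ht with rfl | rfl | ⟨r, -, rfl⟩
    · rw [ProperPair.size_first, hp]
    · rw [ProperPair.size_second]
      lia
    · have : r.1.1.size ≤ n + 2 := r.2
      rw [Function.comp_apply, ProperPair.size_center]
      lia
  · change p.1.size = n + 1 at hp
    rw [ProperPair.size_first, hp]

/-! ### Densities -/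

theorem tendsto_ballCount : Tendsto (fun n => (ballCount n : ℝ)) atTop atTop := by
  rw [← tendsto_add_atTop_iff_nat 1]
  refine tendsto_atTop_mono (fun n => ?_) ((tendsto_add_atTop_iff_nat 1).2
    tendsto_reducedCount_atTop)
  rw [ballCount, Finset.sum_range_succ]
  exact_mod_cast Nat.le_add_left _ _

/-- Summing the termwise bound with some l' < l leaves a constant error. It and C are absorbed by (l
- l') `ballCount n`, which tends to infinity. -/
theorem eventually_ballCount_succ_le {l : ℝ} (hl : 8 + 4 * √3 < l) (C : ℝ) :
    ∀ᶠ n in atTop, (ballCount (n + 1) : ℝ) + C ≤ l * ballCount n := by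
  obtain ⟨l', hl', hl''⟩ := exists_between hl
  obtain ⟨N, hN⟩ := eventually_atTop.1 (eventually_reducedCount_succ_le hl')
  have hl0 : 0 ≤ l' := by
    have := Real.sqrt_nonneg 3
    linarith
  have h : ∀ n ≥ N, (ballCount (n + 1) : ℝ) ≤ ballCount (N + 1) + l' * ballCount n := by
    intro n hn
    induction n, hn using Nat.le_induction with
    | base => linarith [show 0 ≤ l' * (ballCount N : ℝ) by positivity]
    | succ n hn ih =>
      have h1 : (ballCount (n + 1 + 1) : ℝ) = ballCount (n + 1) + reducedCount (n + 1 + 1) := by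
        rw [ballCount, Finset.sum_range_succ, ← ballCount]
        push_cast
        ring
      have h2 : (ballCount (n + 1) : ℝ) = ballCount n + reducedCount (n + 1) := by
        rw [ballCount, Finset.sum_range_succ, ← ballCount]
        push_cast
        ring
      have h3 := hN (n + 1) (by lia)
      rw [h1]
      have h4 : l' * (ballCount (n + 1) : ℝ) = l' * ballCount n + l' * reducedCount (n + 1) := by
        rw [h2]
        ring
      linarith
  have hc : 0 < l - l' := by linarith
  filter_upwards [eventually_ge_atTop N,
    (tendsto_ballCount.const_mul_atTop hc).eventually_ge_atTop (ballCount (N + 1) + C)] with n h1 h2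
  linarith [h n h1]

theorem eventually_ballCount_add_le {l : ℝ} (hl : 8 + 4 * √3 < l) {C : ℝ} (hC : 0 ≤ C) (j : ℕ) :
    ∀ᶠ n in atTop, (ballCount (n + (j + 1)) : ℝ) + C ≤ l ^ (j + 1) * ballCount n := by
  have hl0 : 0 ≤ l := by
    have := Real.sqrt_nonneg 3
    linarith
  induction j with
  | zero => simpa using eventually_ballCount_succ_le hl C
  | succ j ih =>
    filter_upwards [(tendsto_add_atTop_nat 1).eventually ih, eventually_ballCount_succ_le hl C] with
      n h1 h2
    rw [show n + (j + 1 + 1) = n + 1 + (j + 1) by ring]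
    have h3 := mul_le_mul_of_nonneg_left (show (ballCount (n + 1) : ℝ) ≤ l * ballCount n by linarith)
      (pow_nonneg hl0 (j + 1))
    rw [pow_succ l (j + 1), mul_assoc]
    linarith

theorem eventually_reducedCount_add_le {l : ℝ} (hl : 8 + 4 * √3 < l) (j : ℕ) :
    ∀ᶠ n in atTop, (reducedCount (n + j) : ℝ) ≤ l ^ j * reducedCount n := by
  have hl0 : 0 ≤ l := by
    have := Real.sqrt_nonneg 3
    linarith
  induction j with
  | zero => simp
  | succ j ih =>
    filter_upwards [(tendsto_add_atTop_nat 1).eventually ih, eventually_reducedCount_succ_le hl] with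
      n h1 h2
    rw [show n + (j + 1) = n + 1 + j by ring]
    have h3 := mul_le_mul_of_nonneg_left h2 (pow_nonneg hl0 j)
    rw [pow_succ l j, mul_assoc]
    linarith

theorem pow_le_factorial_mul_multichoose (n k : ℕ) : n ^ k ≤ k.factorial * n.multichoose k := by
  rcases n.eq_zero_or_pos with rfl | hn
  · cases k <;> simp
  · obtain ⟨n, rfl⟩ := Nat.exists_eq_add_of_le' hn
    rw [Nat.multichoose_eq, show n + 1 + k - 1 = n + k by lia,
      ← Nat.ascFactorial_eq_factorial_mul_choose]
    exact Nat.pow_succ_le_ascFactorial _ _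

theorem factorial_mul_multichoose_le (n k : ℕ) :
    k.factorial * (n + 1).multichoose k ≤ (n + 1 + k) ^ k := by
  rw [Nat.multichoose_eq, show n + 1 + k - 1 = n + k by lia,
    ← Nat.ascFactorial_eq_factorial_mul_choose]
  refine (Nat.ascFactorial_le_pow_add n k).trans (Nat.pow_le_pow_left (by lia) k)

/-- The exponent is 4 + 5 + 3k, from the size offsets of the components. The factor k + 1 is the
quotient of the factorials (k + 1)! and k! that clear the two multiset counts. -/
theorem eventually_le_sphereRatio {l : ℝ} (hl : 8 + 4 * √3 < l) (k : ℕ) :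
    ∀ᶠ n in atTop, (k + 1) / l ^ (9 + 3 * k) ≤
      sphereRatio (generatingTuples (k + 2) ⊤) n := by
  rw [← map_add_atTop_eq_nat 5, eventually_map]
  have hl0 : 0 < l := by
    have := Real.sqrt_nonneg 3
    linarith
  have hC : (0 : ℝ) ≤ k + 2 := by positivity
  filter_upwards [(tendsto_add_atTop_nat 1).eventually (eventually_reducedCount_add_le hl 4),
    eventually_ballCount_add_le hl hC 4,
    (tendsto_add_atTop_nat 2).eventually (eventually_ballCount_add_le hl hC 2),
    (tendsto_add_atTop_nat 1).eventually (tendsto_reducedCount_atTop.eventually_gt_atTop 0),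
    tendsto_ballCount.eventually_gt_atTop 0,
    (tendsto_add_atTop_nat 2).eventually (tendsto_ballCount.eventually_gt_atTop 0)] with
    n h1 h2 h3 h4 h5 h6
  have hlow : (k.factorial : ℝ) * (generatingTuples (k + 2) ⊤ ∩ sphMax (k + 2) (n + 5)).ncard ≥
      reducedCount (n + 1) * (ballCount n * ballCount (n + 2) ^ k) := by
    have e1 := le_ncard_generatingTuples k n
    have e2 := pow_le_factorial_mul_multichoose (ballCount (n + 2)) k
    have e3 : reducedCount (n + 1) * (ballCount n * ballCount (n + 2) ^ k) ≤
        k.factorial * (generatingTuples (k + 2) ⊤ ∩ sphMax (k + 2) (n + 5)).ncard := by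
      calc _ ≤ reducedCount (n + 1) * (ballCount n *
            (k.factorial * (ballCount (n + 2)).multichoose k)) := by gcongr
        _ = k.factorial * (reducedCount (n + 1) * (ballCount n *
            (ballCount (n + 2)).multichoose k)) := by ring
        _ ≤ _ := by gcongr
    exact_mod_cast e3
  have hup : ((k + 1).factorial : ℝ) * (sphMax (k + 2) (n + 5)).ncard ≤
      reducedCount (n + 5) * (ballCount (n + 5) + (k + 2)) ^ (k + 1) := by
    have e1 := ncard_sphMax_le (k := k + 1) (n := n + 5) (by lia)
    have e2 := factorial_mul_multichoose_le (ballCount (n + 5)) (k + 1)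
    have e3 : (k + 1).factorial * (sphMax (k + 2) (n + 5)).ncard ≤
        reducedCount (n + 5) * (ballCount (n + 5) + (k + 2)) ^ (k + 1) := by
      calc _ ≤ (k + 1).factorial * (reducedCount (n + 5) *
            (ballCount (n + 5) + 1).multichoose (k + 1)) := by gcongr
        _ = reducedCount (n + 5) * ((k + 1).factorial *
            (ballCount (n + 5) + 1).multichoose (k + 1)) := by ring
        _ ≤ reducedCount (n + 5) * (ballCount (n + 5) + 1 + (k + 1)) ^ (k + 1) := by gcongr
        _ = _ := by ring
    exact_mod_cast e3
  have hcmp : (reducedCount (n + 5) : ℝ) * (ballCount (n + 5) + (k + 2)) ^ (k + 1) ≤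
      l ^ (9 + 3 * k) * (reducedCount (n + 1) * (ballCount n * ballCount (n + 2) ^ k)) := by
    calc (reducedCount (n + 5) : ℝ) * (ballCount (n + 5) + (k + 2)) ^ (k + 1)
        = reducedCount (n + 1 + 4) * ((ballCount (n + (4 + 1)) + (k + 2)) *
            (ballCount (n + 2 + (2 + 1)) + (k + 2)) ^ k) := by
          rw [pow_succ' _ k]
      _ ≤ (l ^ 4 * reducedCount (n + 1)) * ((l ^ (4 + 1) * ballCount n) *
            (l ^ (2 + 1) * ballCount (n + 2)) ^ k) := by gcongr
      _ = _ := by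
          rw [mul_pow, ← pow_mul, pow_add l 9]
          ring
  -- An empty sphere would make the quotient 0 by convention.
  have hpos : (0 : ℝ) < (sphMax (k + 2) (n + 5)).ncard := by
    have e1 : (0 : ℝ) < k.factorial *
        (generatingTuples (k + 2) ⊤ ∩ sphMax (k + 2) (n + 5)).ncard :=
      lt_of_lt_of_le (by positivity) hlow
    refine (pos_of_mul_pos_right e1 (by positivity)).trans_le ?_
    exact_mod_cast Set.ncard_le_ncard Set.inter_subset_right (sphMax_finite _ _)
  rw [sphereRatio, div_le_div_iff₀ (by positivity) hpos]
  have hf : (0 : ℝ) < k.factorial := by positivity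
  rw [Nat.factorial_succ] at hup
  push_cast at hup
  refine le_of_mul_le_mul_left ?_ hf
  have := mul_le_mul_of_nonneg_left hlow (show 0 ≤ l ^ (9 + 3 * k) by positivity)
  linarith

theorem le_lowerDensity_of_eventually_le {k : ℕ} {T : Set (Sym ReducedTreePair k)} {c : ℝ}
    (h : ∀ᶠ n in atTop, c ≤ sphereRatio T n) : c ≤ lowerDensity T := by
  refine le_liminf_of_le ?_ h
  -- A real `liminf` is meaningful only under boundedness; the proportions are at most 1.
  refine IsBoundedUnder.isCoboundedUnder_ge ⟨1, eventually_map.2 (Eventually.of_forall fun n => ?_)⟩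
  refine div_le_one_of_le₀ ?_ (by positivity)
  exact_mod_cast Set.ncard_le_ncard Set.inter_subset_right (sphMax_finite k n)

theorem le_lowerDensity_generatingTuples (k : ℕ) :
    1 / ((k : ℝ) + 2) / (8 + 4 * √3) ^ (9 + 3 * k) ≤
      lowerDensity (generatingTuples (k + 2) ⊤) := by
  have h3 := Real.sqrt_nonneg 3
  set μ := 8 + 4 * √3 with hμ
  have hμ0 : 0 < μ := by linarith
  have hN : 0 < μ ^ (9 + 3 * k) := by positivity
  -- The bound for l > μ has the constant k + 1 in place of 1/(k + 2). This slack of (k + 1)(k + 2)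
  -- ≥ 2 allows one fixed l close to μ instead of a limit.
  have hev : ∀ᶠ x in 𝓝 μ, x ^ (9 + 3 * k) < 2 * μ ^ (9 + 3 * k) :=
    (continuous_pow (9 + 3 * k)).continuousAt.eventually_lt_const (by linarith)
  obtain ⟨l, hl, hl'⟩ := ((hev.filter_mono nhdsWithin_le_nhds).and
    (self_mem_nhdsWithin (s := Set.Ioi μ))).exists
  replace hl' : μ < l := hl'
  have hl0 : 0 < l := hμ0.trans hl'
  refine le_trans ?_ (le_lowerDensity_of_eventually_le (eventually_le_sphereRatio hl' k))
  rw [div_div, div_le_div_iff₀ (by positivity) (by positivity), one_mul]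
  have hk : (0 : ℝ) ≤ k := by positivity
  calc l ^ (9 + 3 * k) ≤ 2 * μ ^ (9 + 3 * k) := hl.le
    _ ≤ ((k + 1) * (k + 2)) * μ ^ (9 + 3 * k) :=
        mul_le_mul_of_nonneg_right (by nlinarith) hN.le
    _ = _ := by ring

theorem mainTheorem4 :
    (∀ k : ℕ, 2 ≤ k →
      (⊤ : Subgroup ThompsonF) ∈ specMax k ∧
      1 / (k : ℝ) * (8 + 4 * √3) ^ (-9 : ℤ) * (8 + 4 * √3) ^ (-3 * ((k : ℤ) - 2)) ≤
        lowerDensity (generatingTuples k ⊤) ∧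
      ∀ d : ℝ, HasDensity (generatingTuples k ⊤) d →
        1 / (k : ℝ) * (8 + 4 * √3) ^ (-9 : ℤ) * (8 + 4 * √3) ^ (-3 * ((k : ℤ) - 2)) ≤ d ∧ 0 < d) ∧
    IsPersistent ⊤ := by
  have h3 := Real.sqrt_nonneg 3
  have hμ0 : 0 < 8 + 4 * √3 := by linarith
  have key : ∀ k : ℕ, 2 ≤ k →
      0 < 1 / (k : ℝ) * (8 + 4 * √3) ^ (-9 : ℤ) * (8 + 4 * √3) ^ (-3 * ((k : ℤ) - 2)) ∧
      1 / (k : ℝ) * (8 + 4 * √3) ^ (-9 : ℤ) * (8 + 4 * √3) ^ (-3 * ((k : ℤ) - 2)) ≤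
        lowerDensity (generatingTuples k ⊤) := by
    intro k hk
    obtain ⟨k, rfl⟩ := Nat.exists_eq_add_of_le' hk
    refine ⟨by positivity, le_trans (le_of_eq ?_) (le_lowerDensity_generatingTuples k)⟩
    rw [mul_assoc, ← zpow_add₀ hμ0.ne', div_eq_mul_inv (1 / ((k : ℝ) + 2)), ← zpow_natCast,
      ← zpow_neg]
    push_cast
    congr 2
    ring
  refine ⟨fun k hk => ⟨(key k hk).1.trans_le (key k hk).2, (key k hk).2, fun d hd => ?_⟩, 2,
    fun k hk => (key k hk).1.trans_le (key k hk).2⟩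
  rw [← show lowerDensity (generatingTuples k ⊤) = d from hd.liminf_eq]
  exact ⟨(key k hk).2, (key k hk).1.trans_le (key k hk).2⟩
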